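/- Let $1\le r<n\le m$, let $M=M^*+E\in\mathbb{R}^{n\times m}$ be a fully observed noisy matrix ($M$ is arbitrary), with singular values $\sigma_1(M)\ge\cdots\ge\sigma_n(M)\ge 0$, and let $\Sigma=\mathrm{Diag}(\sigma_1(M),\dots,\sigma_n(M))\in\mathbb{R}^{n\times m}$, so that $\sigma_i(\Sigma)=\sigma_i(M)$. For $\lambda>0$, $U\in\mathbb{R}^{n\times r}$ and $V\in\mathbb{R}^{m\times r}$ put $$\Phi_\lambda(U,V)=\tfrac12\|UV^{\mathsf T}-M\|_F^2+\tfrac\lambda2\big(\|U\|_F^2+\|V\|_F^2\big),\qquad \widetilde\Phi_\lambda(U,V)=\tfrac12\|UV^{\mathsf T}-\Sigma\|_F^2+\tfrac\lambda2\big(\|U\|_F^2+\|V\|_F^2\big),$$ and equip the space of pairs with the norm $\|(U,V)\|_F=(\|U\|_F^2+\|V\|_F^2)^{1/2}$. Suppose that $\sigma_r(\Sigma)>\sigma_{r+1}(\Sigma)$. Let $\widetilde\sigma_1>\cdots>\widetilde\sigma_s$ be the distinct values among $\sigma_1(\Sigma),\dots,\sigma_r(\Sigma)$, and set $\widetilde\sigma_0=+\infty$,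 $\widetilde\sigma_{s+1}=0$. (a) Let $0\le k\le s$ and $\lambda\in(\widetilde\sigma_{k+1},\widetilde\sigma_k)$, and let $(\overline U,\overline V)$ be any global minimizer of $\widetilde\Phi_\lambda$. Then there is a constant $\eta>0$ such that for every $$\delta\le\min\Big\{\frac{\sqrt{\widetilde\sigma_k-\lambda}}{2},\ \frac{\lambda-\widetilde\sigma_{k+1}}{2\sqrt{\widetilde\sigma_1}},\ \frac{\widetilde\sigma_s-\sigma_{r+1}(\Sigma)}{4\sqrt{\widetilde\sigma_1}}\Big\}$$ (the first term being $+\infty$ when $k=0$) and every $(U,V)$ in the closed ball of radius $\delta$ around $(\overline U,\overline V)$, $$\|\nabla\widetilde\Phi_\lambda(U,V)\|_F^2\ \ge\ \eta\,\big[\widetilde\Phi_\lambda(U,V)-\widetilde\Phi_\lambda(\overline U,\overline V)\big].$$ (b) Consequently, for every $\lambda$ as in (a), and hence for Lebesgue-almost every $\lambda>0$, $\widetilde\Phi_\lambda$ has the Kurdyka–Łojasiewicz (KL) property of exponent $1/2$ at each of its global minimizers, and $\Phi_\lambda$ has the KL property of exponent $1/2$ at each of its global minimizers. Here $h$ has the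 KL property of exponent $1/2$ at $\bar x\in\mathrm{dom}\,\partial h$ if there are $c>0$, $\eta'\in(0,\infty]$ and a neighbourhood $\mathcal U$ of $\bar x$ such that, with $\varphi(t)=c\sqrt t$, $\varphi'(h(x)-h(\bar x))\,\mathrm{dist}(0,\partial h(x))\ge1$ for all $x\in\mathcal U$ with $h(\bar x)<h(x)<h(\bar x)+\eta'$, where $\partial h$ is the limiting subdifferential. -/

import Mathlib

open Set Filter Topology MeasureTheory

noncomputable section

/-! ### Subdifferentials and the Kurdyka-Lojasiewicz property -/

/-- The regular (Frechet) subdifferential of `h` at `x`: those `v` with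
`h y ≥ h x + ⟪v, y - x⟫ + o(‖y - x‖)` as `y → x`. -/
def regularSubdiff {E : Type*} [NormedAddCommGroup E] [InnerProductSpace ℝ E]
    (h : E → ℝ) (x : E) : Set E :=
  {v | ∀ ε : ℝ, 0 < ε → ∀ᶠ y in 𝓝 x, h x + inner ℝ v (y - x) - ε * ‖y - x‖ ≤ h y}

/-- The limiting (Mordukhovich) subdifferential of `h` at `x`. -/
def limitingSubdiff {E : Type*} [NormedAddCommGroup E] [InnerProductSpace ℝ E]
    (h : E → ℝ) (x : E) : Set E :=
  {v | ∃ (y : ℕ → E) (w : ℕ → E), Tendsto y atTop (𝓝 x) ∧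
      Tendsto (fun i => h (y i)) atTop (𝓝 (h x)) ∧
      (∀ i, w i ∈ regularSubdiff h (y i)) ∧ Tendsto w atTop (𝓝 v)}

/-- `φ` is an admissible desingularizing function on `[0, η)`, where `η ∈ (0, ∞]`. -/
structure IsDesingularizing (η : EReal) (φ : ℝ → ℝ) : Prop where
  nonneg : ∀ s : ℝ, 0 ≤ s → (s : EReal) < η → 0 ≤ φ s
  continuousOn : ContinuousOn φ {s : ℝ | 0 ≤ s ∧ (s : EReal) < η}
  concaveOn : ConcaveOn ℝ {s : ℝ | 0 ≤ s ∧ (s : EReal) < η} φ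
  map_zero : φ 0 = 0
  contDiffOn : ContDiffOn ℝ 1 φ {s : ℝ | 0 < s ∧ (s : EReal) < η}
  deriv_pos : ∀ s : ℝ, 0 < s → (s : EReal) < η → 0 < deriv φ s

/-- The KL inequality for `h` at `xbar` holds with desingularizing function `φ`, on a neighbourhood
of `xbar` intersected with `[h xbar < h < h xbar + η]`, for some `η ∈ (0, ∞]`.
The distance is extended-valued, so that `dist(0, ∅) = ∞`. -/
def HasKLWith {E : Type*} [NormedAddCommGroup E] [InnerProductSpace ℝ E]
    (h : E → ℝ) (xbar : E) (φ : ℝ → ℝ) : Prop :=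
  (limitingSubdiff h xbar).Nonempty ∧
  ∃ η : EReal, 0 < η ∧ IsDesingularizing η φ ∧ ∃ N ∈ 𝓝 xbar,
    ∀ x ∈ N, 0 < h x - h xbar → ((h x - h xbar : ℝ) : EReal) < η →
      1 ≤ ENNReal.ofReal (deriv φ (h x - h xbar)) * Metric.infEDist 0 (limitingSubdiff h x)

/-- The KL property of `h` at `xbar` with exponent `1/2`: one can take `φ s = c √s`, `c > 0`. -/
def HasKLHalf {E : Type*} [NormedAddCommGroup E] [InnerProductSpace ℝ E]
    (h : E → ℝ) (xbar : E) : Prop :=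
  ∃ c : ℝ, 0 < c ∧ HasKLWith h xbar (fun s => c * √s)

/-! ### Factored least squares -/

/-- The `i`-th largest singular value `σ_i(M)`, counted with multiplicity, for `i = 1, 2, …`
(Mathlib's sequence starts at index `0`). -/
def singVal {n m : ℕ} (M : Matrix (Fin n) (Fin m) ℝ) (i : ℕ) : ℝ :=
  (Matrix.toEuclideanLin M).singularValues (i - 1)

/-- `Σ = Diag(σ(M))`, the rectangular diagonal matrix with the ordered singular values of `M`. -/
def sigmaMat {n m : ℕ} (M : Matrix (Fin n) (Fin m) ℝ) : Matrix (Fin n) (Fin m) ℝ :=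
  Matrix.of fun i j => if (i : ℕ) = (j : ℕ) then singVal M ((i : ℕ) + 1) else 0

/-- Squared Frobenius norm. -/
def frobSq {a b : ℕ} (A : Matrix (Fin a) (Fin b) ℝ) : ℝ := ∑ i, ∑ j, A i j ^ 2

/-- The space of pairs `(U, V)` of an `n × r` and an `m × r` matrix, as a Euclidean space:
its norm is `(‖U‖_F² + ‖V‖_F²)^(1/2)`. -/
abbrev FactorSpace (n m r : ℕ) : Type :=
  WithLp 2 (EuclideanSpace ℝ (Fin n × Fin r) × EuclideanSpace ℝ (Fin m × Fin r))

/-- The component `U` of a pair `(U, V)`. -/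
def facU {n m r : ℕ} (p : FactorSpace n m r) : Matrix (Fin n) (Fin r) ℝ :=
  Matrix.of fun i a => p.fst (i, a)

/-- The component `V` of a pair `(U, V)`. -/
def facV {n m r : ℕ} (p : FactorSpace n m r) : Matrix (Fin m) (Fin r) ℝ :=
  Matrix.of fun j a => p.snd (j, a)

/-- `Phi D lam (U, V) = ½ ‖U Vᵀ - D‖_F² + (lam / 2) (‖U‖_F² + ‖V‖_F²)`. -/
def Phi {n m r : ℕ} (D : Matrix (Fin n) (Fin m) ℝ) (lam : ℝ) (p : FactorSpace n m r) : ℝ :=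
  1 / 2 * frobSq (facU p * (facV p).transpose - D)
    + lam / 2 * (frobSq (facU p) + frobSq (facV p))

/-- The set of global minimizers of a function. -/
def globalMinimizers {E : Type*} (h : E → ℝ) : Set E := {p | ∀ q, h p ≤ h q}

end

section

open Matrix

/-! ### Spectral decompositions and the min-max principle -/

/-! At a critical pair the two partial gradients force `UᵀU = VᵀV`. After a rotation `(UR, VR)`,
which changes neither the objective nor the gradient norm, the columns are orthogonal, the `a`-th
columns of `U` and `V` share the squared length `g a`, and each nonzero pair of columns is a
singular pair of `D` with singular value `lam + g a`. The critical value is `½‖D‖² - ½ ∑ (g a)²`, so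
it depends on `g` alone. The min-max principle bounds `g` from above by the spectrum of `DᵀD`. It
also bounds it from below once `D` is small on the complement of the columns of `V`; at a minimizer
this holds because a column could otherwise be exchanged for a better one. Hence `g i = max (σ i -
lam) 0` at every minimizer.

If `lam` avoids the first `r` singular values and there is a gap after the `r`-th, the smallness on
the complement is strict. Then the Hessian is injective on a complement of the tangent space to the
rotation orbit (`hessian_injective`). Procrustes alignment moves any nearby point into that
complement, where the gradient is at least a multiple of the distance and the excess value at most a
multiple of its square. This gives gradient domination near each minimizer
(`exists_gradient_domination`), and so the KL exponent `1/2`.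

On a ball of the stated radius, perturbation of singular values shows that every critical point is
again a global minimizer (`factorObj_eq_of_close`). Local domination then holds at every point of
the ball, at noncritical points by continuity, and compactness yields one constant. Only the
spectrum of `DᵀD` enters, so the same argument serves `M` and its diagonal form; the excluded `lam`
form a finite set. -/

theorem exists_ne_zero_linearMap_eq_zero {ι κ : Type*} [Fintype ι] [Fintype κ]
    (f : (ι → ℝ) →ₗ[ℝ] (κ → ℝ)) (h : Fintype.card κ < Fintype.card ι) :
    ∃ t, t ≠ 0 ∧ f t = 0 := by
  have hk : LinearMap.ker f ≠ ⊥ := f.ker_ne_bot_of_finrank_lt (by simpa using h)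
  obtain ⟨t, ht, h0⟩ := Submodule.exists_mem_ne_zero_of_ne_bot hk
  exact ⟨t, h0, by simpa using ht⟩

/-- `A = Q diag(a) Qᵀ` with `Q` orthogonal and `a` decreasing. -/
structure IsSpectralDecomp {N : ℕ} (A Q : Matrix (Fin N) (Fin N) ℝ) (a : Fin N → ℝ) : Prop where
  orthogonal : Qᵀ * Q = 1
  antitone : Antitone a
  eq : A = Q * diagonal a * Qᵀ

namespace IsSpectralDecomp

variable {N : ℕ} {A Q : Matrix (Fin N) (Fin N) ℝ} {a : Fin N → ℝ}

theorem dotProduct_self (h : IsSpectralDecomp A Q a) (z : Fin N → ℝ) :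
    z ⬝ᵥ z = ∑ j, (Qᵀ *ᵥ z) j ^ 2 := by
  have h1 : Q * Qᵀ = 1 := mul_eq_one_comm.mp h.orthogonal
  have : (Qᵀ *ᵥ z) ⬝ᵥ (Qᵀ *ᵥ z) = z ⬝ᵥ z := by
    rw [dotProduct_mulVec, vecMul_transpose, mulVec_mulVec, h1, one_mulVec]
  rw [← this]
  simp [dotProduct, sq]

theorem dotProduct_mulVec (h : IsSpectralDecomp A Q a) (z : Fin N → ℝ) :
    z ⬝ᵥ (A *ᵥ z) = ∑ j, a j * (Qᵀ *ᵥ z) j ^ 2 := by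
  rw [h.eq, ← mulVec_mulVec, ← mulVec_mulVec, Matrix.dotProduct_mulVec, ← mulVec_transpose]
  simp only [dotProduct, mulVec_diagonal]
  exact Finset.sum_congr rfl fun j _ => by ring

/-- Min-max from below: the range of `w` has dimension greater than `i`, so it contains a nonzero
vector with vanishing first `i` eigencoordinates, and there the form is at most `a i` times the
squared norm. -/
theorem le_of_forall_le (h : IsSpectralDecomp A Q a) {ι : Type*} [Fintype ι]
    (w : Matrix (Fin N) ι ℝ) (i : Fin N) (hi : (i : ℕ) < Fintype.card ι)
    (hw : ∀ t, w *ᵥ t = 0 → t = 0) {c : ℝ}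
    (hc : ∀ t, c * ((w *ᵥ t) ⬝ᵥ (w *ᵥ t)) ≤ (w *ᵥ t) ⬝ᵥ (A *ᵥ (w *ᵥ t))) : c ≤ a i := by
  by_contra hlt
  push Not at hlt
  -- The map reads off the first `i` eigencoordinates of `w *ᵥ t`.
  obtain ⟨t, ht0, ht⟩ := exists_ne_zero_linearMap_eq_zero
    ((LinearMap.funLeft ℝ ℝ (Fin.castLE i.2.le)) ∘ₗ (Qᵀ * w).mulVecLin) (by simpa using hi)
  have hy : ∀ j < i, (Qᵀ *ᵥ (w *ᵥ t)) j = 0 := fun j hj => by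
    rw [mulVec_mulVec]
    exact congrFun ht ⟨j, hj⟩
  have h1 := hc t
  have hz : w *ᵥ t ≠ 0 := fun h0 => ht0 (hw t h0)
  have hpos : 0 < (w *ᵥ t) ⬝ᵥ (w *ᵥ t) := by
    simpa using (dotProduct_star_self_pos_iff (v := w *ᵥ t)).mpr hz
  have h2 : (w *ᵥ t) ⬝ᵥ (A *ᵥ (w *ᵥ t)) ≤ a i * ((w *ᵥ t) ⬝ᵥ (w *ᵥ t)) := by
    rw [h.dotProduct_mulVec, h.dotProduct_self, Finset.mul_sum]
    refine Finset.sum_le_sum fun j _ => ?_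
    rcases lt_or_ge j i with hj | hj
    · simp [hy j hj]
    · exact mul_le_mul_of_nonneg_right (h.antitone hj) (sq_nonneg _)
  nlinarith

/-- The lower bound of the min-max principle for an orthogonal family that is also orthogonal
with respect to the quadratic form. -/
theorem le_of_orthogonal_family (h : IsSpectralDecomp A Q a) {ι : Type*} [Fintype ι]
    [DecidableEq ι] (w : ι → Fin N → ℝ) (i : Fin N) (hi : (i : ℕ) < Fintype.card ι)
    (hw0 : ∀ k, w k ≠ 0) (hw : ∀ k l, k ≠ l → w k ⬝ᵥ w l = 0)
    (hwA : ∀ k l, k ≠ l → w k ⬝ᵥ (A *ᵥ w l) = 0) {c : ℝ}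
    (hc : ∀ k, c * (w k ⬝ᵥ w k) ≤ w k ⬝ᵥ (A *ᵥ w k)) : c ≤ a i := by
  have hsum : ∀ t : ι → ℝ, (of w)ᵀ *ᵥ t = ∑ k, t k • w k := fun t => by
    ext j
    simp [mulVec, dotProduct, mul_comm]
  have hzz : ∀ t : ι → ℝ, (∑ k, t k • w k) ⬝ᵥ (∑ k, t k • w k) =
      ∑ k, t k ^ 2 * (w k ⬝ᵥ w k) := fun t => by
    simp only [sum_dotProduct, dotProduct_sum, smul_dotProduct, dotProduct_smul, smul_eq_mul]
    refine Finset.sum_congr rfl fun k _ => ?_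
    rw [Finset.sum_eq_single k (fun l _ hl => by simp [hw l k hl]) (by simp)]
    ring
  have hzA : ∀ t : ι → ℝ, (∑ k, t k • w k) ⬝ᵥ (A *ᵥ (∑ k, t k • w k)) =
      ∑ k, t k ^ 2 * (w k ⬝ᵥ (A *ᵥ w k)) := fun t => by
    simp only [mulVec_sum, mulVec_smul, sum_dotProduct, dotProduct_sum, smul_dotProduct,
      dotProduct_smul, smul_eq_mul]
    refine Finset.sum_congr rfl fun k _ => ?_
    rw [Finset.sum_eq_single k (fun l _ hl => by simp [hwA l k hl]) (by simp)]
    ring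
  have hpos : ∀ k, 0 < w k ⬝ᵥ w k := fun k => by
    simpa using (dotProduct_star_self_pos_iff (v := w k)).mpr (hw0 k)
  refine h.le_of_forall_le (of w)ᵀ i hi (fun t ht => ?_) (fun t => ?_)
  · rw [hsum] at ht
    have h0 := hzz t
    rw [ht, zero_dotProduct, eq_comm,
      Finset.sum_eq_zero_iff_of_nonneg fun k _ => mul_nonneg (sq_nonneg _) (hpos k).le] at h0
    ext k
    simpa [(hpos k).ne'] using h0 k (Finset.mem_univ k)
  · rw [hsum, hzz, hzA, Finset.mul_sum]
    exact Finset.sum_le_sum fun k _ => by nlinarith [hc k, sq_nonneg (t k)]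

/-- Min-max from above: at most `i` linear conditions leave a nonzero vector in the span of the
first `i + 1` eigenvectors, where the form is at least `a i` times the squared norm. -/
theorem ge_of_forall_le (h : IsSpectralDecomp A Q a) {ι : Type*} [Fintype ι]
    (w : Matrix ι (Fin N) ℝ) (i : Fin N) (hi : Fintype.card ι ≤ i) {c : ℝ}
    (hc : ∀ z, w *ᵥ z = 0 → z ⬝ᵥ (A *ᵥ z) ≤ c * (z ⬝ᵥ z)) : a i ≤ c := by
  by_contra hlt
  push Not at hlt
  let S : (Fin (i + 1) → ℝ) →ₗ[ℝ] (Fin N → ℝ) :=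
    Function.ExtendByZero.linearMap ℝ (Fin.castLE i.2)
  obtain ⟨t, ht0, ht⟩ := exists_ne_zero_linearMap_eq_zero
    ((w * Q).mulVecLin ∘ₗ S) (by simpa using Nat.lt_succ_of_le hi)
  have hSv : ∀ j, S t (Fin.castLE i.2 j) = t j := fun j =>
    (Fin.castLE_injective i.2).extend_apply t (0 : Fin N → ℝ) j
  have hS0 : ∀ j, ¬ j ≤ i → S t j = 0 := fun j hj =>
    Function.extend_apply' t (0 : Fin N → ℝ) j fun ⟨k, hk⟩ =>
      hj (hk ▸ Fin.le_def.mpr (Nat.le_of_lt_succ k.2))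
  have hQ : Qᵀ *ᵥ (Q *ᵥ S t) = S t := by rw [mulVec_mulVec, h.orthogonal, one_mulVec]
  have h1 := hc (Q *ᵥ S t) (by simpa [mulVec_mulVec] using ht)
  have hne : S t ≠ 0 := fun h0 => ht0 (by ext j; rw [← hSv, h0]; rfl)
  rw [h.dotProduct_mulVec, h.dotProduct_self, hQ, Finset.mul_sum] at h1
  have hpos : 0 < ∑ j, S t j ^ 2 := by
    have := (dotProduct_star_self_pos_iff (v := S t)).mpr hne
    simpa [dotProduct, sq] using this
  have h2 : a i * ∑ j, S t j ^ 2 ≤ ∑ j, a j * S t j ^ 2 := by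
    rw [Finset.mul_sum]
    refine Finset.sum_le_sum fun j _ => ?_
    by_cases hj : j ≤ i
    · exact mul_le_mul_of_nonneg_right (h.antitone hj) (sq_nonneg _)
    · simp [hS0 j hj]
  rw [← Finset.mul_sum] at h1
  nlinarith

end IsSpectralDecomp

/-! ### Spectral decompositions of symmetric matrices and of Gram matrices. -/

/-- The operator `T` is kept apart from `A` so that Gram matrices can use the adjoint composition,
whose eigenvalues are the squared singular values. -/
theorem isSpectralDecomp_of_isSymmetric {N : ℕ} (A : Matrix (Fin N) (Fin N) ℝ)
    {T : EuclideanSpace ℝ (Fin N) →ₗ[ℝ] EuclideanSpace ℝ (Fin N)} (hT : T.IsSymmetric)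
    (hA : T = toEuclideanLin A) (hN : Module.finrank ℝ (EuclideanSpace ℝ (Fin N)) = N) :
    ∃ Q, IsSpectralDecomp A Q (hT.eigenvalues hN) := by
  let b := hT.eigenvectorBasis hN
  let Q : Matrix (Fin N) (Fin N) ℝ := of fun i j => b j i
  have hQ : Qᵀ * Q = 1 := by
    ext i j
    have := b.inner_eq_ite i j
    simp only [PiLp.inner_apply, RCLike.inner_apply, conj_trivial] at this
    rw [mul_apply, one_apply, ← this]
    exact Finset.sum_congr rfl fun k _ => by simp [Q, mul_comm]
  refine ⟨Q, hQ, hT.eigenvalues_antitone hN, ?_⟩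
  have hAQ : A * Q = Q * diagonal (hT.eigenvalues hN) := by
    ext i j
    have := congrArg (fun v => v i) (hT.apply_eigenvectorBasis hN j)
    rw [mul_diagonal, mul_apply, mul_comm]
    refine Eq.trans ?_ this
    subst hA
    rfl
  rw [← hAQ, Matrix.mul_assoc, mul_eq_one_comm.mp hQ, Matrix.mul_one]

theorem exists_isSpectralDecomp {N : ℕ} {A : Matrix (Fin N) (Fin N) ℝ} (hA : Aᵀ = A) :
    ∃ Q a, IsSpectralDecomp A Q a := by
  have hT : (toEuclideanLin A).IsSymmetric :=
    isSymmetric_toEuclideanLin_iff.mpr (by rw [IsHermitian, conjTranspose_eq_transpose_of_trivial, hA])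
  obtain ⟨Q, h⟩ := isSpectralDecomp_of_isSymmetric A hT rfl (by simp)
  exact ⟨Q, _, h⟩

theorem singVal_nonneg {n m : ℕ} (M : Matrix (Fin n) (Fin m) ℝ) (i : ℕ) : 0 ≤ singVal M i :=
  LinearMap.singularValues_nonneg _ _

theorem singVal_antitone {n m : ℕ} (M : Matrix (Fin n) (Fin m) ℝ) : Antitone (singVal M) :=
  fun _ _ h => LinearMap.singularValues_antitone _ (Nat.sub_le_sub_right h 1)

theorem isSpectralDecomp_gram {n m : ℕ} (M : Matrix (Fin n) (Fin m) ℝ) :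
    ∃ Q, IsSpectralDecomp (Mᵀ * M) Q fun j => singVal M (j + 1) ^ 2 := by
  have hN : Module.finrank ℝ (EuclideanSpace ℝ (Fin m)) = m := by simp
  obtain ⟨Q, h⟩ := isSpectralDecomp_of_isSymmetric (Mᵀ * M)
    (toEuclideanLin M).isSymmetric_adjoint_comp_self (by
      rw [← toEuclideanLin_conjTranspose_eq_adjoint, conjTranspose_eq_transpose_of_trivial]
      ext v i
      simp [toLpLin_apply, mulVec_mulVec]) hN
  refine ⟨Q, ?_⟩
  convert h using 2 with j
  simp [singVal, LinearMap.sq_singularValues_fin _ hN]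

/-- The eigenvalues coincide with those of `Mᵀ * M`, which is all that later results need in order
to treat `M` and `sigmaMat M` alike. -/
theorem isSpectralDecomp_gram_sigmaMat {n m : ℕ} (M : Matrix (Fin n) (Fin m) ℝ) :
    IsSpectralDecomp ((sigmaMat M)ᵀ * sigmaMat M) 1 fun j => singVal M (j + 1) ^ 2 := by
  refine ⟨by simp, fun i j hij => ?_, ?_⟩
  · have := singVal_antitone M (Nat.succ_le_succ (Fin.le_def.mp hij))
    have h0 := singVal_nonneg M (j + 1)
    exact pow_le_pow_left₀ h0 this 2
  · ext j k
    simp only [mul_apply, transpose_apply, sigmaMat, of_apply, transpose_one, 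
      Matrix.one_mul, diagonal_apply]
    by_cases hj : (j : ℕ) < n
    · rw [Finset.sum_eq_single ⟨j, hj⟩]
      · by_cases hjk : j = k
        · simp [hjk, sq]
        · simp [hjk, Fin.val_inj]
      · intro i _ hi
        have : (i : ℕ) ≠ j := fun h => hi (Fin.ext h)
        simp [this]
      · simp
    -- Columns beyond the `n`-th are zero, and so are these singular values because the rank is at
    -- most `n`.
    · have h0 : singVal M (j + 1) = 0 := by
        rw [singVal, LinearMap.singularValues_eq_zero_iff_le_finrank_range]
        refine (Submodule.finrank_le _).trans ?_
        simp; omega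
      rw [h0]
      rw [Finset.sum_eq_zero]
      · simp
      · intro i _
        have : (i : ℕ) ≠ j := fun h => hj (h ▸ i.2)
        simp [this]

/-! ### Critical pairs of the regularized factorization -/

theorem dotProduct_self_pos {N : ℕ} {z : Fin N → ℝ} (hz : z ≠ 0) : 0 < z ⬝ᵥ z := by
  simpa using (dotProduct_star_self_pos_iff (v := z)).mpr hz

theorem dotProduct_gram_mulVec {n m : ℕ} (D : Matrix (Fin n) (Fin m) ℝ) (z : Fin m → ℝ) :
    z ⬝ᵥ ((Dᵀ * D) *ᵥ z) = (D *ᵥ z) ⬝ᵥ (D *ᵥ z) := by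
  rw [← mulVec_mulVec, dotProduct_mulVec, vecMul_transpose]

theorem frobSq_eq_trace {a b : ℕ} (A : Matrix (Fin a) (Fin b) ℝ) : frobSq A = (Aᵀ * A).trace := by
  simp only [frobSq, trace, diag_apply, mul_apply, transpose_apply]
  rw [Finset.sum_comm]
  exact Finset.sum_congr rfl fun _ _ => Finset.sum_congr rfl fun _ _ => by ring

theorem frobSq_transpose {a b : ℕ} (A : Matrix (Fin a) (Fin b) ℝ) : frobSq Aᵀ = frobSq A :=
  Finset.sum_comm

theorem frobSq_nonneg {a b : ℕ} (A : Matrix (Fin a) (Fin b) ℝ) : 0 ≤ frobSq A :=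
  Finset.sum_nonneg fun _ _ => Finset.sum_nonneg fun _ _ => sq_nonneg _

theorem diagonal_const_add {r : ℕ} (c : ℝ) (g : Fin r → ℝ) :
    (diagonal fun a => c + g a) = c • (1 : Matrix (Fin r) (Fin r) ℝ) + diagonal g := by
  ext i j
  by_cases hij : i = j <;> simp [hij]

/-- The regularized factorization objective as a function of two matrices. -/
noncomputable def factorObj {n m r : ℕ} (D : Matrix (Fin n) (Fin m) ℝ) (lam : ℝ)
    (U : Matrix (Fin n) (Fin r) ℝ) (V : Matrix (Fin m) (Fin r) ℝ) : ℝ :=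
  1 / 2 * frobSq (U * Vᵀ - D) + lam / 2 * (frobSq U + frobSq V)

/-- The partial gradients of the objective vanish at `(U, V)`. -/
structure IsCriticalPair {n m r : ℕ} (D : Matrix (Fin n) (Fin m) ℝ) (lam : ℝ)
    (U : Matrix (Fin n) (Fin r) ℝ) (V : Matrix (Fin m) (Fin r) ℝ) : Prop where
  left : (U * Vᵀ - D) * V + lam • U = 0
  right : (U * Vᵀ - D)ᵀ * U + lam • V = 0

/-- A critical pair whose columns are ordered orthogonal families. -/
structure IsDiagCriticalPair {n m r : ℕ} (D : Matrix (Fin n) (Fin m) ℝ) (lam : ℝ)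
    (U : Matrix (Fin n) (Fin r) ℝ) (V : Matrix (Fin m) (Fin r) ℝ) (g : Fin r → ℝ) : Prop where
  antitone : Antitone g
  gram_left : Uᵀ * U = diagonal g
  gram_right : Vᵀ * V = diagonal g
  mul_right : D * V = U * diagonal fun a => lam + g a
  mul_left : Dᵀ * U = V * diagonal fun a => lam + g a

section

variable {n m r : ℕ} {D : Matrix (Fin n) (Fin m) ℝ} {lam : ℝ}
  {U : Matrix (Fin n) (Fin r) ℝ} {V : Matrix (Fin m) (Fin r) ℝ} {g : Fin r → ℝ}

/-- Multiplying the first equation by `Uᵀ` on the left and the transposed second one by `V` on the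
right produces the same term `Uᵀ(UVᵀ - D)V`. -/
theorem IsCriticalPair.gram_eq (h : IsCriticalPair D lam U V) (hlam : lam ≠ 0) :
    Uᵀ * U = Vᵀ * V := by
  have h1 := congrArg (Uᵀ * ·) h.left
  have h2 := congrArg (fun A => Aᵀ * V) h.right
  simp only [Matrix.mul_add, Matrix.mul_smul, Matrix.mul_zero, transpose_add, transpose_mul,
    transpose_transpose, Matrix.add_mul, Matrix.mul_assoc, transpose_smul, Matrix.smul_mul,
    transpose_zero, Matrix.zero_mul] at h1 h2
  have h3 : lam • (Uᵀ * U) = lam • (Vᵀ * V) := add_left_cancel (h1.trans h2.symm)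
  exact smul_right_injective _ hlam h3

theorem IsCriticalPair.isDiag (h : IsCriticalPair D lam U V) (hlam : lam ≠ 0)
    (hU : Uᵀ * U = diagonal g) (hg : Antitone g) : IsDiagCriticalPair D lam U V g := by
  have hV : Vᵀ * V = diagonal g := (h.gram_eq hlam).symm.trans hU
  refine ⟨hg, hU, hV, ?_, ?_⟩
  · have := h.left
    rw [Matrix.sub_mul, Matrix.mul_assoc, hV] at this
    rw [diagonal_const_add, Matrix.mul_add, Matrix.mul_smul, Matrix.mul_one]
    rw [← sub_eq_zero, ← neg_eq_zero, ← this]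
    abel
  · have := h.right
    rw [transpose_sub, transpose_mul, transpose_transpose, Matrix.sub_mul, Matrix.mul_assoc,
      hU] at this
    rw [diagonal_const_add, Matrix.mul_add, Matrix.mul_smul, Matrix.mul_one]
    rw [← sub_eq_zero, ← neg_eq_zero, ← this]
    abel

/-- Value of the objective at a pair of matrices with orthogonal columns. -/
theorem factorObj_of_orthogonal {α β : Fin r → ℝ} (hU : Uᵀ * U = diagonal α)
    (hV : Vᵀ * V = diagonal β) :
    factorObj D lam U V = 1 / 2 * frobSq D + ∑ a, (1 / 2 * (α a * β a) - Uᵀ a ⬝ᵥ (D *ᵥ Vᵀ a)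
      + lam / 2 * (α a + β a)) := by
  have h1 : frobSq (U * Vᵀ - D) = frobSq D - 2 * (Uᵀ * (D * V)).trace + ∑ a, α a * β a := by
    have e1 : ((V * Uᵀ) * (U * Vᵀ)).trace = ∑ a, α a * β a := by
      rw [Matrix.mul_assoc, trace_mul_comm, Matrix.mul_assoc, Matrix.mul_assoc, hV,
        ← Matrix.mul_assoc, hU, diagonal_mul_diagonal, trace_diagonal]
    have e2 : (Dᵀ * (U * Vᵀ)).trace = (Uᵀ * (D * V)).trace := by
      rw [← trace_transpose (Uᵀ * (D * V))]
      simp only [transpose_mul, transpose_transpose]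
      rw [Matrix.mul_assoc, trace_mul_comm Vᵀ, Matrix.mul_assoc]
    have e3 : (V * Uᵀ * D).trace = (Uᵀ * (D * V)).trace := by
      rw [Matrix.mul_assoc, trace_mul_comm, Matrix.mul_assoc]
    rw [frobSq_eq_trace, frobSq_eq_trace, transpose_sub, transpose_mul, transpose_transpose,
      Matrix.sub_mul, Matrix.mul_sub, Matrix.mul_sub, trace_sub, trace_sub, trace_sub, e1, e2, e3]
    ring
  have h2 : (Uᵀ * (D * V)).trace = ∑ a, Uᵀ a ⬝ᵥ (D *ᵥ Vᵀ a) := rfl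
  have h3 : frobSq U = ∑ a, α a := by rw [frobSq_eq_trace, hU, trace_diagonal]
  have h4 : frobSq V = ∑ a, β a := by rw [frobSq_eq_trace, hV, trace_diagonal]
  rw [factorObj, h1, h2, h3, h4]
  simp only [Finset.sum_add_distrib, Finset.sum_sub_distrib, ← Finset.mul_sum]
  ring

/-! ### Diagonal critical pairs against the spectrum of `DᵀD`. -/

namespace IsDiagCriticalPair

theorem left_dotProduct (h : IsDiagCriticalPair D lam U V g) (a b : Fin r) :
    Uᵀ a ⬝ᵥ Uᵀ b = if a = b then g a else 0 :=
  (congrFun₂ h.gram_left a b).trans (diagonal_apply ..)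

theorem right_dotProduct (h : IsDiagCriticalPair D lam U V g) (a b : Fin r) :
    Vᵀ a ⬝ᵥ Vᵀ b = if a = b then g a else 0 :=
  (congrFun₂ h.gram_right a b).trans (diagonal_apply ..)

theorem mulVec_right (h : IsDiagCriticalPair D lam U V g) (a : Fin r) :
    D *ᵥ Vᵀ a = (lam + g a) • Uᵀ a := by
  ext i
  have := congrFun₂ h.mul_right i a
  rw [mul_diagonal, mul_comm] at this
  exact this

theorem mulVec_left (h : IsDiagCriticalPair D lam U V g) (a : Fin r) :
    Dᵀ *ᵥ Uᵀ a = (lam + g a) • Vᵀ a := by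
  ext i
  have := congrFun₂ h.mul_left i a
  rw [mul_diagonal, mul_comm] at this
  exact this

theorem gram_mulVec (h : IsDiagCriticalPair D lam U V g) (a : Fin r) :
    (Dᵀ * D) *ᵥ Vᵀ a = (lam + g a) ^ 2 • Vᵀ a := by
  rw [← mulVec_mulVec, h.mulVec_right, mulVec_smul, h.mulVec_left, smul_smul, sq]

theorem nonneg (h : IsDiagCriticalPair D lam U V g) (a : Fin r) : 0 ≤ g a := by
  have := h.left_dotProduct a a
  rw [if_pos rfl] at this
  rw [← this]
  simpa using dotProduct_star_self_nonneg (Uᵀ a)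

theorem left_eq_zero (h : IsDiagCriticalPair D lam U V g) {a : Fin r} (ha : g a = 0) :
    Uᵀ a = 0 := by
  by_contra h0
  have := dotProduct_self_pos h0
  rw [h.left_dotProduct, if_pos rfl, ha] at this
  exact lt_irrefl _ this

theorem right_eq_zero (h : IsDiagCriticalPair D lam U V g) {a : Fin r} (ha : g a = 0) :
    Vᵀ a = 0 := by
  by_contra h0
  have := dotProduct_self_pos h0
  rw [h.right_dotProduct, if_pos rfl, ha] at this
  exact lt_irrefl _ this

theorem right_ne_zero (h : IsDiagCriticalPair D lam U V g) {a : Fin r} (ha : 0 < g a) :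
    Vᵀ a ≠ 0 := fun h0 => by
  have := h.right_dotProduct a a
  rw [h0, if_pos rfl, zero_dotProduct] at this
  exact ha.ne this

theorem factorObj_eq (h : IsDiagCriticalPair D lam U V g) :
    factorObj D lam U V = 1 / 2 * frobSq D - 1 / 2 * ∑ a, g a ^ 2 := by
  rw [factorObj_of_orthogonal h.gram_left h.gram_right, sub_eq_add_neg, ← mul_neg,
    ← Finset.sum_neg_distrib, Finset.mul_sum]
  congr 1
  refine Finset.sum_congr rfl fun a _ => ?_
  rw [h.mulVec_right, dotProduct_smul, h.left_dotProduct, if_pos rfl, smul_eq_mul]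
  ring

variable {Q : Matrix (Fin m) (Fin m) ℝ} {σ : ℕ → ℝ}

/-- The columns of `V` up to index `i` are nonzero orthogonal eigenvectors of `DᵀD` with eigenvalues
at least `(lam + g i) ^ 2`. -/
theorem add_le (h : IsDiagCriticalPair D lam U V g) (hlam : 0 < lam) (hrm : r ≤ m)
    (hS : IsSpectralDecomp (Dᵀ * D) Q fun j => σ j ^ 2) (hσ : ∀ i, 0 ≤ σ i)
    {i : Fin r} (hi : 0 < g i) : lam + g i ≤ σ i := by
  have key : (lam + g i) ^ 2 ≤ σ i ^ 2 := by
    have hle : ∀ l : Fin (i + 1), Fin.castLE i.2 l ≤ i := fun l =>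
      Fin.le_def.mpr (Nat.le_of_lt_succ l.2)
    refine hS.le_of_orthogonal_family (fun l : Fin (i + 1) => Vᵀ (Fin.castLE i.2 l))
      (Fin.castLE hrm i) (by simp) (fun l => ?_) (fun k l hkl => ?_) (fun k l hkl => ?_)
      (fun l => ?_)
    · exact h.right_ne_zero (hi.trans_le (h.antitone (hle l)))
    · rw [h.right_dotProduct, if_neg fun e => hkl (Fin.castLE_injective _ e)]
    · rw [h.gram_mulVec, dotProduct_smul, h.right_dotProduct,
        if_neg fun e => hkl (Fin.castLE_injective _ e), smul_zero]
    · rw [h.gram_mulVec, dotProduct_smul, h.right_dotProduct, if_pos rfl, smul_eq_mul]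
      have h1 := h.antitone (hle l)
      exact mul_le_mul_of_nonneg_right (pow_le_pow_left₀ (by positivity) (by linarith) 2)
        (h.nonneg _)
  exact le_of_sq_le_sq key (hσ _)

/-- If `D` is small on the orthogonal complement of the columns of `V`, then the columns of `V`
are leading right singular vectors. -/
theorem le_add (h : IsDiagCriticalPair D lam U V g) (hlam : 0 < lam) (hrm : r ≤ m)
    (hS : IsSpectralDecomp (Dᵀ * D) Q fun j => σ j ^ 2)
    (hcomp : ∀ b z, Vᵀ *ᵥ z = 0 → z ⬝ᵥ ((Dᵀ * D) *ᵥ z) ≤ (lam + g b) ^ 2 * (z ⬝ᵥ z))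
    (i : Fin r) : σ i ≤ lam + g i := by
  refine le_of_sq_le_sq ?_ (add_nonneg hlam.le (h.nonneg i))
  refine hS.ge_of_forall_le (of fun l : Fin i => Vᵀ (Fin.castLE i.2.le l)) (Fin.castLE hrm i)
    (by simp) fun z hz => ?_
  have hz0 : ∀ b < i, Vᵀ b ⬝ᵥ z = 0 := fun b hb => congrFun hz ⟨b, hb⟩
  set A := Dᵀ * D with hA
  -- Coefficients of the projection of `z` onto the columns of `V`. Where `g b = 0` the column
  -- vanishes, so the default value of the division is harmless.
  let c : Fin r → ℝ := fun b => (Vᵀ b ⬝ᵥ z) / g b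
  have hVc : Vᵀ *ᵥ (V *ᵥ c) = Vᵀ *ᵥ z := by
    rw [mulVec_mulVec, h.gram_right]
    ext b
    rw [mulVec_diagonal]
    change g b * ((Vᵀ b ⬝ᵥ z) / g b) = Vᵀ b ⬝ᵥ z
    rcases (h.nonneg b).eq_or_lt with hb | hb
    · rw [h.right_eq_zero hb.symm]
      simp
    · field_simp
  have hAV : A *ᵥ (V *ᵥ c) = V *ᵥ fun b => (lam + g b) ^ 2 * c b := by
    have : A * V = V * diagonal fun b => (lam + g b) ^ 2 := by
      ext j b
      rw [mul_diagonal, mul_comm]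
      exact congrFun (h.gram_mulVec b) j
    rw [mulVec_mulVec, this, ← mulVec_mulVec]
    congr 1
    ext b
    rw [mulVec_diagonal]
  have hAt : Aᵀ = A := by rw [hA, transpose_mul, transpose_transpose]
  let z' := z - V *ᵥ c
  have hz' : Vᵀ *ᵥ z' = 0 := by rw [mulVec_sub, hVc, sub_self]
  have hort : ∀ d, (V *ᵥ d) ⬝ᵥ z' = 0 := fun d => by
    rw [← vecMul_transpose, ← dotProduct_mulVec, hz', dotProduct_zero]
  have hzd : z = V *ᵥ c + z' := by simp [z']
  have hVV : ∀ d, (V *ᵥ c) ⬝ᵥ (V *ᵥ d) = ∑ b, c b * (g b * d b) := fun d => by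
    rw [← vecMul_transpose, ← dotProduct_mulVec, mulVec_mulVec, h.gram_right]
    simp [dotProduct, mulVec_diagonal]
  have e1 : z ⬝ᵥ z = ∑ b, c b * (g b * c b) + z' ⬝ᵥ z' := by
    rw [hzd, add_dotProduct, dotProduct_add, dotProduct_add, hort, dotProduct_comm z', hort, hVV]
    ring
  have e2 : z ⬝ᵥ (A *ᵥ z) = ∑ b, c b * (g b * ((lam + g b) ^ 2 * c b)) + z' ⬝ᵥ (A *ᵥ z') := by
    have hx : (V *ᵥ c) ⬝ᵥ (A *ᵥ z') = 0 := by
      rw [dotProduct_mulVec, ← mulVec_transpose, hAt, hAV, hort]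
    rw [hzd, mulVec_add, add_dotProduct, dotProduct_add, dotProduct_add, hx, hAV,
      dotProduct_comm z' (V *ᵥ _), hort, hVV]
    ring
  have h3 : ∑ b, c b * (g b * ((lam + g b) ^ 2 * c b)) ≤
      (lam + g i) ^ 2 * ∑ b, c b * (g b * c b) := by
    rw [Finset.mul_sum]
    refine Finset.sum_le_sum fun b _ => ?_
    -- The first `i` coefficients vanish by the choice of `z`; the others carry eigenvalues at most
    -- `(lam + g i) ^ 2`.
    rcases lt_or_ge b i with hb | hb
    · simp [c, hz0 b hb]
    · have hgb := h.nonneg b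
      have h5 : (lam + g b) ^ 2 ≤ (lam + g i) ^ 2 :=
        pow_le_pow_left₀ (by positivity) (by linarith [h.antitone hb]) 2
      nlinarith [mul_le_mul_of_nonneg_right h5 (mul_nonneg hgb (sq_nonneg (c b)))]
  have h4 := hcomp i z' hz'
  rw [e1, e2]
  linarith

theorem eq_max (h : IsDiagCriticalPair D lam U V g) (hlam : 0 < lam) (hrm : r ≤ m)
    (hS : IsSpectralDecomp (Dᵀ * D) Q fun j => σ j ^ 2) (hσ : ∀ i, 0 ≤ σ i)
    (hcomp : ∀ b z, Vᵀ *ᵥ z = 0 → z ⬝ᵥ ((Dᵀ * D) *ᵥ z) ≤ (lam + g b) ^ 2 * (z ⬝ᵥ z))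
    (i : Fin r) : g i = max (σ i - lam) 0 := by
  have h1 := h.le_add hlam hrm hS hcomp i
  rcases (h.nonneg i).eq_or_lt with h0 | h0
  · rw [max_eq_right (by linarith), h0]
  · have h2 := h.add_le hlam hrm hS hσ h0
    rw [max_eq_left (by linarith)]
    linarith

/-- A critical pair that catches enough of the spectrum of `D` catches the leading part of it, with
a strict gap to the remaining part. -/
theorem lt_of_orthogonal (h : IsDiagCriticalPair D lam U V g) (hlam : 0 < lam) (hrm : r < m)
    (hS : IsSpectralDecomp (Dᵀ * D) Q fun j => σ j ^ 2) (hσ : ∀ i, 0 ≤ σ i)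
    (hne : ∀ i < r, σ i ≠ lam) (hpos : ∀ i : Fin r, lam < σ i → 0 < g i)
    {l : Fin r} (hl : ∀ b, b ≤ l) (hlast : 0 < g l → σ r < lam + g l)
    {z : Fin m → ℝ} (hz : z ≠ 0) (hVz : Vᵀ *ᵥ z = 0) :
    z ⬝ᵥ ((Dᵀ * D) *ᵥ z) < (lam + g l) ^ 2 * (z ⬝ᵥ z) := by
  by_contra! hcon
  classical
  have hgl : ∀ b, g l ≤ g b := fun b => h.antitone (hl b)
  have hgl0 := h.nonneg l
  have hVz' : ∀ b, Vᵀ b ⬝ᵥ z = 0 := fun b => congrFun hVz b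
  let k := Fintype.card {b // 0 < g b}
  have hkr : k ≤ r := by simpa using Fintype.card_subtype_le fun b => 0 < g b
  -- A bad `z` joins the `k` nonzero columns, giving `k + 1` orthogonal vectors on which the form is
  -- at least `(lam + g l) ^ 2` times the squared norm.
  have key : (lam + g l) ^ 2 ≤ σ k ^ 2 := by
    refine hS.le_of_orthogonal_family (ι := Option {b // 0 < g b})
      (fun o => o.elim z fun b => Vᵀ b) ⟨k, by omega⟩ (by simp [k]) ?_ ?_ ?_ ?_
    · rintro (_ | ⟨b, hb⟩)
      · exact hz
      · exact h.right_ne_zero hb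
    · rintro (_ | b) (_ | b') hbb
      · exact absurd rfl hbb
      · simpa [dotProduct_comm] using hVz' b'
      · simpa using hVz' b
      · have : (b : Fin r) ≠ b' := fun e => hbb (congrArg some (Subtype.ext e))
        simpa [this] using h.right_dotProduct b b'
    · rintro (_ | b) (_ | b') hbb
      · exact absurd rfl hbb
      · simp only [Option.elim]
        rw [h.gram_mulVec, dotProduct_smul, dotProduct_comm, hVz', smul_zero]
      · simp only [Option.elim]
        rw [dotProduct_mulVec, ← mulVec_transpose, transpose_mul, transpose_transpose,
          h.gram_mulVec, smul_dotProduct, hVz', smul_zero]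
      · have : (b : Fin r) ≠ b' := fun e => hbb (congrArg some (Subtype.ext e))
        simp only [Option.elim]
        rw [h.gram_mulVec, dotProduct_smul, h.right_dotProduct, if_neg this, smul_zero]
    · rintro (_ | b)
      · exact hcon
      · simp only [Option.elim]
        rw [h.gram_mulVec, dotProduct_smul, h.right_dotProduct, if_pos rfl, smul_eq_mul]
        exact mul_le_mul_of_nonneg_right
          (pow_le_pow_left₀ (by positivity) (by linarith [hgl b]) 2) (h.nonneg _)
  have key' : lam + g l ≤ σ k := le_of_sq_le_sq key (hσ k)
  -- If `g l = 0`, then `k < r` and `lam < σ k`, so the first `k + 1` entries of `g` are positive,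
  -- although only `k` are. Otherwise `k = r`, against the gap in `hlast`.
  rcases hgl0.eq_or_lt with h0 | h0
  · have hk : k < r := by
      refine lt_of_lt_of_eq (Fintype.card_subtype_lt (x := l) ?_) (Fintype.card_fin r)
      rw [← h0]
      exact lt_irrefl _
    have hgk : 0 < g ⟨k, hk⟩ :=
      hpos ⟨k, hk⟩ (lt_of_le_of_ne (by simpa [← h0] using key') (hne k hk).symm)
    have hinj : Function.Injective fun b : Fin (k + 1) =>
        (⟨Fin.castLE hk b, hgk.trans_le (h.antitone (Fin.le_def.mpr (Nat.le_of_lt_succ b.2)))⟩ :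
          {b // 0 < g b}) := fun b b' hb => by
      simpa using hb
    have := Fintype.card_le_of_injective _ hinj
    rw [Fintype.card_fin] at this
    change k + 1 ≤ k at this
    omega
  · have hk : k = r := by
      have : Fintype.card {b // 0 < g b} = (Finset.univ : Finset (Fin r)).card :=
        Fintype.card_of_subtype _ fun b => by simpa using h0.trans_le (hgl b)
      simpa using this
    rw [hk] at key'
    linarith [hlast h0]

/-- At a minimizer, `D` is small on the orthogonal complement of the columns of `V`: otherwise a
column could be replaced by a better pair of vectors. -/
theorem le_of_isMin (h : IsDiagCriticalPair D lam U V g) (hlam : 0 < lam)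
    (hmin : ∀ (U' : Matrix (Fin n) (Fin r) ℝ) V', factorObj D lam U V ≤ factorObj D lam U' V')
    (a : Fin r) (z : Fin m → ℝ) (hVz : Vᵀ *ᵥ z = 0) :
    z ⬝ᵥ ((Dᵀ * D) *ᵥ z) ≤ (lam + g a) ^ 2 * (z ⬝ᵥ z) := by
  rcases eq_or_ne z 0 with rfl | hz
  · simp
  have hzz := dotProduct_self_pos hz
  rw [dotProduct_gram_mulVec]
  have hga := h.nonneg a
  by_contra! hcon
  have hDz : 0 < (D *ᵥ z) ⬝ᵥ (D *ᵥ z) := lt_of_le_of_lt (by positivity) hcon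
  set q := (D *ᵥ z) ⬝ᵥ (D *ᵥ z) with hq
  -- The ratio `‖Dz‖ / ‖z‖` plays the role of a singular value above `lam + g a`.
  let θ := √(q / (z ⬝ᵥ z))
  have hθ2 : θ ^ 2 = q / (z ⬝ᵥ z) := Real.sq_sqrt (by positivity)
  have hθ : lam + g a < θ := by
    refine lt_of_pow_lt_pow_left₀ 2 (Real.sqrt_nonneg _) ?_
    rw [hθ2, lt_div_iff₀ hzz]
    exact hcon
  have hγ : 0 < θ - lam := by linarith
  -- This scale gives both replacement columns the squared length `θ - lam`, so the new pair
  -- contributes `-(θ - lam)² / 2`, less than the old `-(g a)² / 2`.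
  let s := √((θ - lam) / (z ⬝ᵥ z))
  have hs2 : s * s = (θ - lam) / (z ⬝ᵥ z) := Real.mul_self_sqrt (by positivity)
  have hθ0 : 0 < θ := by linarith
  have hq' : q = θ ^ 2 * (z ⬝ᵥ z) := by rw [hθ2]; field_simp
  let x : Fin n → ℝ := (s / θ) • (D *ᵥ z)
  let y : Fin m → ℝ := s • z
  have hVz' : ∀ b, Vᵀ b ⬝ᵥ z = 0 := fun b => congrFun hVz b
  have hUx : ∀ b, Uᵀ b ⬝ᵥ x = 0 := fun b => by
    rw [dotProduct_smul, dotProduct_mulVec, ← mulVec_transpose, h.mulVec_left, smul_dotProduct,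
      hVz', smul_zero, smul_zero]
  have hVy : ∀ b, Vᵀ b ⬝ᵥ y = 0 := fun b => by rw [dotProduct_smul, hVz', smul_zero]
  have hyy : y ⬝ᵥ y = θ - lam := by
    simp only [y, dotProduct_smul, smul_dotProduct, smul_eq_mul, ← mul_assoc]
    rw [hs2]
    field_simp
  have hxx : x ⬝ᵥ x = θ - lam := by
    simp only [x, dotProduct_smul, smul_dotProduct, smul_eq_mul, ← hq]
    rw [hq', show s / θ * (s / θ * (θ ^ 2 * (z ⬝ᵥ z))) = (s * s) * (z ⬝ᵥ z) by field_simp, hs2]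
    field_simp
  have hxDy : x ⬝ᵥ (D *ᵥ y) = (θ - lam) * θ := by
    simp only [x, y, mulVec_smul, dotProduct_smul, smul_dotProduct, smul_eq_mul, ← hq]
    rw [hq', show s * (s / θ * (θ ^ 2 * (z ⬝ᵥ z))) = (s * s) * θ * (z ⬝ᵥ z) by field_simp, hs2]
    field_simp
  let U' : Matrix (Fin n) (Fin r) ℝ := (Uᵀ.updateRow a x)ᵀ
  let V' : Matrix (Fin m) (Fin r) ℝ := (Vᵀ.updateRow a y)ᵀ
  have hgram : ∀ {N : ℕ} {W : Matrix (Fin N) (Fin r) ℝ} {w : Fin N → ℝ},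
      Wᵀ * W = diagonal g → (∀ b, Wᵀ b ⬝ᵥ w = 0) → w ⬝ᵥ w = θ - lam →
      (Wᵀ.updateRow a w)ᵀᵀ * (Wᵀ.updateRow a w)ᵀ = diagonal (Function.update g a (θ - lam)) := by
    intro N W w hW hw hww
    ext b c
    have hWbc : Wᵀ b ⬝ᵥ Wᵀ c = diagonal g b c := congrFun₂ hW b c
    change (Wᵀ.updateRow a w) b ⬝ᵥ (Wᵀ.updateRow a w) c = _
    by_cases hb : b = a <;> by_cases hc : c = a
    · subst hb hc
      simp [hww]
    · subst hb
      rw [updateRow_self, updateRow_ne hc, dotProduct_comm, hw, diagonal_apply_ne' _ hc]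
    · subst hc
      rw [updateRow_self, updateRow_ne hb, hw, diagonal_apply_ne _ hb]
    · rw [updateRow_ne hb, updateRow_ne hc, hWbc, diagonal_apply, diagonal_apply,
        Function.update_of_ne hb]
  have hle := hmin U' V'
  rw [factorObj_of_orthogonal (hgram h.gram_left hUx hxx) (hgram h.gram_right hVy hyy),
    h.factorObj_eq, sub_eq_add_neg, add_le_add_iff_left, ← mul_neg, ← Finset.sum_neg_distrib,
    Finset.mul_sum, ← Finset.add_sum_erase _ _ (Finset.mem_univ a),
    ← Finset.add_sum_erase _ (fun b => 1 / 2 * (_ * _) - _ + _) (Finset.mem_univ a)] at hle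
  have hrest : ∀ b ∈ Finset.univ.erase a, 1 / 2 * (Function.update g a (θ - lam) b *
      Function.update g a (θ - lam) b) - U'ᵀ b ⬝ᵥ (D *ᵥ V'ᵀ b) + lam / 2 *
      (Function.update g a (θ - lam) b + Function.update g a (θ - lam) b) =
      1 / 2 * -(g b ^ 2) := by
    intro b hb
    have hba := Finset.ne_of_mem_erase hb
    have e1 : U'ᵀ b = Uᵀ b := updateRow_ne hba
    have e2 : V'ᵀ b = Vᵀ b := updateRow_ne hba
    rw [e1, e2, h.mulVec_right, dotProduct_smul, h.left_dotProduct, if_pos rfl, smul_eq_mul,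
      Function.update_of_ne hba]
    ring
  rw [Finset.sum_congr rfl hrest, add_le_add_iff_right] at hle
  have e1 : U'ᵀ a = x := updateRow_self
  have e2 : V'ᵀ a = y := updateRow_self
  rw [e1, e2, hxDy, Function.update_self] at hle
  nlinarith

end IsDiagCriticalPair

end

/-! ### Rotation invariance, nondegeneracy and perturbation of critical pairs -/

theorem dotProduct_mulVec_self_le {a b : ℕ} (A : Matrix (Fin a) (Fin b) ℝ) (z : Fin b → ℝ) :
    (A *ᵥ z) ⬝ᵥ (A *ᵥ z) ≤ frobSq A * (z ⬝ᵥ z) := by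
  simp only [frobSq, dotProduct, mulVec]
  rw [Finset.sum_mul]
  refine Finset.sum_le_sum fun i _ => ?_
  refine (pow_two (∑ k, A i k * z k)).symm.le.trans ((Finset.sum_mul_sq_le_sq_mul_sq _ _ _).trans_eq ?_)
  simp [sq]

section

variable {n m r : ℕ} {D : Matrix (Fin n) (Fin m) ℝ} {lam : ℝ}
  {U : Matrix (Fin n) (Fin r) ℝ} {V : Matrix (Fin m) (Fin r) ℝ} {g : Fin r → ℝ}
  {R : Matrix (Fin r) (Fin r) ℝ}

theorem mul_mul_transpose_of_orthogonal (hR : Rᵀ * R = 1) (U : Matrix (Fin n) (Fin r) ℝ)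
    (V : Matrix (Fin m) (Fin r) ℝ) : (U * R) * (V * R)ᵀ = U * Vᵀ := by
  rw [transpose_mul, Matrix.mul_assoc, ← Matrix.mul_assoc R, mul_eq_one_comm.mp hR, Matrix.one_mul]

theorem frobSq_mul_of_orthogonal (hR : Rᵀ * R = 1) (U : Matrix (Fin n) (Fin r) ℝ) :
    frobSq (U * R) = frobSq U := by
  rw [← frobSq_transpose, frobSq_eq_trace, transpose_transpose, mul_mul_transpose_of_orthogonal hR,
    ← frobSq_transpose U, frobSq_eq_trace, transpose_transpose]

theorem factorObj_mul_of_orthogonal (hR : Rᵀ * R = 1) :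
    factorObj D lam (U * R) (V * R) = factorObj D lam U V := by
  rw [factorObj, mul_mul_transpose_of_orthogonal hR, frobSq_mul_of_orthogonal hR,
    frobSq_mul_of_orthogonal hR, factorObj]

theorem IsCriticalPair.mul_orthogonal (h : IsCriticalPair D lam U V) (hR : Rᵀ * R = 1) :
    IsCriticalPair D lam (U * R) (V * R) := by
  constructor
  · rw [mul_mul_transpose_of_orthogonal hR, ← Matrix.mul_assoc, ← Matrix.smul_mul,
      ← Matrix.add_mul, h.left, Matrix.zero_mul]
  · rw [mul_mul_transpose_of_orthogonal hR, ← Matrix.mul_assoc, ← Matrix.smul_mul,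
      ← Matrix.add_mul, h.right, Matrix.zero_mul]

theorem IsCriticalPair.isDiag_of_isSpectralDecomp (h : IsCriticalPair D lam U V) (hlam : lam ≠ 0)
    (hS : IsSpectralDecomp (Uᵀ * U) R g) : IsDiagCriticalPair D lam (U * R) (V * R) g := by
  refine (h.mul_orthogonal hS.orthogonal).isDiag hlam ?_ hS.antitone
  rw [transpose_mul, Matrix.mul_assoc, ← Matrix.mul_assoc Uᵀ, hS.eq]
  simp only [Matrix.mul_assoc, hS.orthogonal, Matrix.mul_one]
  rw [← Matrix.mul_assoc, hS.orthogonal, Matrix.one_mul]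

theorem exists_isSpectralDecomp_gram (U : Matrix (Fin n) (Fin r) ℝ) :
    ∃ R g, IsSpectralDecomp (Uᵀ * U) R g :=
  exists_isSpectralDecomp (by rw [transpose_mul, transpose_transpose])

/-- Perturbation of singular values. -/
theorem IsSpectralDecomp.sqrt_le_sqrt_add {U₁ : Matrix (Fin n) (Fin r) ℝ}
    {R₁ : Matrix (Fin r) (Fin r) ℝ} {g₁ : Fin r → ℝ} (h : IsSpectralDecomp (Uᵀ * U) R g)
    (h₁ : IsSpectralDecomp (U₁ᵀ * U₁) R₁ g₁) {δ : ℝ} (hδ : 0 ≤ δ)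
    (hU : frobSq (U - U₁) ≤ δ ^ 2) (i : Fin r) (hi : 0 ≤ g₁ i) : √(g₁ i) ≤ √(g i) + δ := by
  rcases le_or_gt (√(g₁ i)) δ with hle | hlt
  · linarith [Real.sqrt_nonneg (g i)]
  -- On the span of the top `i + 1` eigenvectors of `U₁ᵀU₁`, `‖U₁z‖ ≥ √(g₁ i) ‖z‖`, hence `‖Uz‖ ≥
  -- (√(g₁ i) - δ) ‖z‖`.
  let w : Matrix (Fin r) (Fin (i + 1)) ℝ := R₁.submatrix id (Fin.castLE i.2)
  have hw : ∀ t j, (R₁ᵀ *ᵥ (w *ᵥ t)) j = ∑ k, (1 : Matrix _ _ ℝ) j (Fin.castLE i.2 k) * t k := by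
    intro t j
    rw [mulVec_mulVec, ← h₁.orthogonal]
    rfl
  have key : (√(g₁ i) - δ) ^ 2 ≤ g i := by
    refine h.le_of_forall_le w i (by simp) (fun t ht => ?_) (fun t => ?_)
    · ext k
      have := hw t (Fin.castLE i.2 k)
      rw [ht, mulVec_zero, Finset.sum_eq_single k] at this
      · simpa using this.symm
      · intro k' _ hk'
        rw [one_apply_ne fun e => hk' (Fin.castLE_injective _ e.symm), zero_mul]
      · simp
    · set z := w *ᵥ t
      have hz0 : ∀ j, i < j → (R₁ᵀ *ᵥ z) j = 0 := fun j hj => by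
        rw [hw]
        refine Finset.sum_eq_zero fun k _ => ?_
        rw [one_apply_ne, zero_mul]
        rintro rfl
        exact absurd (Nat.le_of_lt_succ k.2) (not_le.mpr (Fin.lt_def.mp hj))
      have e1 : g₁ i * (z ⬝ᵥ z) ≤ (U₁ *ᵥ z) ⬝ᵥ (U₁ *ᵥ z) := by
        rw [← dotProduct_gram_mulVec U₁, h₁.dotProduct_mulVec, h₁.dotProduct_self, Finset.mul_sum]
        refine Finset.sum_le_sum fun j _ => ?_
        rcases lt_or_ge i j with hj | hj
        · simp [hz0 j hj]
        · exact mul_le_mul_of_nonneg_right (h₁.antitone hj) (sq_nonneg _)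
      have e2 := dotProduct_mulVec_self_le (U - U₁) z
      rw [dotProduct_gram_mulVec U]
      have hn : ∀ {N : ℕ} (x : Fin N → ℝ), x ⬝ᵥ x = ‖WithLp.toLp 2 x‖ ^ 2 := fun x => by
        rw [EuclideanSpace.real_norm_sq_eq]
        simp [dotProduct, sq]
      have hsub : ‖WithLp.toLp 2 (U₁ *ᵥ z)‖ ≤
          ‖WithLp.toLp 2 (U *ᵥ z)‖ + ‖WithLp.toLp 2 ((U - U₁) *ᵥ z)‖ := by
        rw [sub_mulVec, WithLp.toLp_sub]
        rw [norm_sub_rev]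
        exact norm_le_norm_add_norm_sub' _ _
      rw [hn] at e1 e2
      rw [hn] at e1 e2
      rw [hn, hn, ← mul_pow]
      refine pow_le_pow_left₀ (mul_nonneg (by linarith) (norm_nonneg _)) ?_ 2
      have e1' : √(g₁ i) * ‖WithLp.toLp 2 z‖ ≤ ‖WithLp.toLp 2 (U₁ *ᵥ z)‖ := by
        refine le_of_sq_le_sq ?_ (norm_nonneg _)
        rwa [mul_pow, Real.sq_sqrt hi]
      have e2' : ‖WithLp.toLp 2 ((U - U₁) *ᵥ z)‖ ≤ δ * ‖WithLp.toLp 2 z‖ := by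
        refine le_of_sq_le_sq ?_ (mul_nonneg hδ (norm_nonneg _))
        rw [mul_pow]
        exact e2.trans (mul_le_mul_of_nonneg_right hU (sq_nonneg _))
      linarith
  linarith [Real.le_sqrt_of_sq_le key]

variable {Q : Matrix (Fin m) (Fin m) ℝ} {σ : ℕ → ℝ}

theorem IsDiagCriticalPair.eq_max_of_isMin (h : IsDiagCriticalPair D lam U V g) (hlam : 0 < lam)
    (hrm : r ≤ m) (hS : IsSpectralDecomp (Dᵀ * D) Q fun j => σ j ^ 2) (hσ : ∀ i, 0 ≤ σ i)
    (hmin : ∀ (U' : Matrix (Fin n) (Fin r) ℝ) V', factorObj D lam U V ≤ factorObj D lam U' V')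
    (i : Fin r) : g i = max (σ i - lam) 0 :=
  h.eq_max hlam hrm hS hσ (h.le_of_isMin hlam hmin) i

theorem IsDiagCriticalPair.lt_of_isMin (h : IsDiagCriticalPair D lam U V g) (hlam : 0 < lam)
    (hrm : r < m) (hS : IsSpectralDecomp (Dᵀ * D) Q fun j => σ j ^ 2) (hσ : ∀ i, 0 ≤ σ i)
    (hne : ∀ i < r, σ i ≠ lam) {l : Fin r} (hl : ∀ b, b ≤ l) (hgap : σ r < σ l)
    (hmin : ∀ (U' : Matrix (Fin n) (Fin r) ℝ) V', factorObj D lam U V ≤ factorObj D lam U' V')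
    {z : Fin m → ℝ} (hz : z ≠ 0) (hVz : Vᵀ *ᵥ z = 0) :
    z ⬝ᵥ ((Dᵀ * D) *ᵥ z) < (lam + g l) ^ 2 * (z ⬝ᵥ z) := by
  have hg := h.eq_max_of_isMin hlam hrm.le hS hσ hmin
  refine h.lt_of_orthogonal hlam hrm hS hσ hne (fun i hi => ?_) hl (fun h0 => ?_) hz hVz
  · rw [hg i]
    exact lt_max_of_lt_left (by linarith)
  · rw [hg l] at h0 ⊢
    rcases lt_max_iff.mp h0 with h1 | h1
    · rw [max_eq_left h1.le]
      linarith
    · exact absurd h1 (lt_irrefl _)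

/-- A critical pair close to a minimizer has the minimal value. -/
theorem IsCriticalPair.factorObj_eq_of_close {U₁ : Matrix (Fin n) (Fin r) ℝ}
    {V₁ : Matrix (Fin m) (Fin r) ℝ} (h : IsCriticalPair D lam U V)
    (h₁ : IsCriticalPair D lam U₁ V₁) (hlam : 0 < lam)
    (hrm : r < m) (hS : IsSpectralDecomp (Dᵀ * D) Q fun j => σ j ^ 2) (hσ : ∀ i, 0 ≤ σ i)
    (hne : ∀ i < r, σ i ≠ lam) {l : Fin r} (hl : ∀ b, b ≤ l) (hgap : σ r < σ l)
    (hmin : ∀ (U' : Matrix (Fin n) (Fin r) ℝ) V', factorObj D lam U₁ V₁ ≤ factorObj D lam U' V')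
    {δ : ℝ} (hδ : 0 ≤ δ) (hU : frobSq (U - U₁) ≤ δ ^ 2)
    (hδ₁ : ∀ i < r, lam < σ i → δ < √(σ i - lam))
    (hδ₂ : lam < σ l → √(max (σ r - lam) 0) + δ < √(σ l - lam)) :
    factorObj D lam U V = factorObj D lam U₁ V₁ := by
  obtain ⟨R, g, hR⟩ := exists_isSpectralDecomp_gram U
  obtain ⟨R₁, g₁, hR₁⟩ := exists_isSpectralDecomp_gram U₁
  have hd := h.isDiag_of_isSpectralDecomp hlam.ne' hR
  have hd₁ := h₁.isDiag_of_isSpectralDecomp hlam.ne' hR₁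
  have hg₁ := hd₁.eq_max_of_isMin hlam hrm.le hS hσ fun U' V' => by
    rw [factorObj_mul_of_orthogonal hR₁.orthogonal]
    exact hmin U' V'
  have hw : ∀ i : Fin r, √(g₁ i) ≤ √(g i) + δ := fun i =>
    hR.sqrt_le_sqrt_add hR₁ hδ hU i (hd₁.nonneg i)
  have hg₁' : ∀ i : Fin r, lam < σ i → g₁ i = σ i - lam := fun i hi => by
    rw [hg₁, max_eq_left (by linarith)]
  -- Closeness keeps `g i` positive wherever `lam < σ i`, and keeps `g l` above `σ r - lam`. These
  -- are the hypotheses of `lt_of_orthogonal`, so `g` obeys the formula that holds at minimizers.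
  have hg := hd.eq_max hlam hrm.le hS hσ fun b z hz => by
    rcases eq_or_ne z 0 with rfl | hz0
    · simp
    have h1 := hd.lt_of_orthogonal hlam hrm hS hσ hne (fun i hi => ?_) hl (fun h0 => ?_) hz0 hz
    · refine h1.le.trans (mul_le_mul_of_nonneg_right (pow_le_pow_left₀ ?_ ?_ 2)
        (dotProduct_self_pos hz0).le)
      · linarith [hd.nonneg l]
      · linarith [hd.antitone (hl b)]
    · have h1 := hw i
      have h2 := hδ₁ i i.2 hi
      rw [hg₁' i hi] at h1
      exact Real.sqrt_pos.mp (by linarith)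
    · rcases lt_or_gt_of_ne (hne l l.2) with h1 | h1
      · linarith
      · have h2 := hw l
        have h3 := hδ₂ h1
        rw [hg₁' l h1] at h2
        have h4 : max (σ r - lam) 0 < g l := lt_of_not_ge fun hle => by
          have := Real.sqrt_le_sqrt hle
          linarith
        linarith [le_max_left (σ r - lam) 0]
  rw [← factorObj_mul_of_orthogonal hR.orthogonal, hd.factorObj_eq,
    ← factorObj_mul_of_orthogonal hR₁.orthogonal, hd₁.factorObj_eq]
  simp only [hg, hg₁]

/-- The kernel of the Hessian at a nondegenerate critical pair meets the complement of the
tangent space of the orbit under rotations only at zero. -/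
theorem IsDiagCriticalPair.hessian_injective (h : IsDiagCriticalPair D lam U V g) (hlam : 0 < lam)
    (hlt : ∀ b, ∀ z ≠ 0, Vᵀ *ᵥ z = 0 → z ⬝ᵥ ((Dᵀ * D) *ᵥ z) < (lam + g b) ^ 2 * (z ⬝ᵥ z))
    {X : Matrix (Fin n) (Fin r) ℝ} {Y : Matrix (Fin m) (Fin r) ℝ}
    (hX : (X * Vᵀ + U * Yᵀ) * V + (U * Vᵀ - D) * Y + lam • X = 0)
    (hY : (X * Vᵀ + U * Yᵀ)ᵀ * U + (U * Vᵀ - D)ᵀ * X + lam • Y = 0)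
    (hsym : (Uᵀ * X + Vᵀ * Y)ᵀ = Uᵀ * X + Vᵀ * Y) : X = 0 ∧ Y = 0 := by
  have hUD : Uᵀ * D = (diagonal fun a => lam + g a) * Vᵀ := by
    have := congrArg transpose h.mul_left
    simpa [transpose_mul] using this
  have hVD : Vᵀ * Dᵀ = (diagonal fun a => lam + g a) * Uᵀ := by
    have := congrArg transpose h.mul_right
    simpa [transpose_mul] using this
  set P := Uᵀ * X with hP
  set S := Vᵀ * Y with hS
  have hXU : Xᵀ * U = Pᵀ := by rw [hP, transpose_mul, transpose_transpose]
  have hYV : Yᵀ * V = Sᵀ := by rw [hS, transpose_mul, transpose_transpose]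
  -- Projecting the two equations onto the columns of `U` and `V` leaves a closed system for `P` and
  -- `S`.
  have e1 : ∀ a b, P a b * g b + g a * S b a + lam * (P a b - S a b) = 0 := fun a b => by
    have := congrArg (Uᵀ * ·) hX
    simp only [Matrix.mul_add, Matrix.add_mul, Matrix.sub_mul, Matrix.mul_sub, Matrix.mul_assoc,
      Matrix.mul_zero, Matrix.mul_smul, h.gram_right, hYV, ← hS] at this
    simp only [← Matrix.mul_assoc Uᵀ, h.gram_left, hUD, ← hP] at this
    rw [Matrix.mul_assoc _ Vᵀ Y, ← hS] at this
    have := congrFun₂ this a b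
    simp only [Matrix.add_apply, Matrix.sub_apply, Matrix.smul_apply, mul_diagonal, diagonal_mul, transpose_apply,
      Matrix.zero_apply, smul_eq_mul] at this
    linarith
  have e2 : ∀ a b, S a b * g b + g a * P b a + lam * (S a b - P a b) = 0 := fun a b => by
    have := congrArg (Vᵀ * ·) hY
    simp only [transpose_add, transpose_sub, transpose_mul, transpose_transpose] at this
    simp only [Matrix.mul_add, Matrix.add_mul, Matrix.sub_mul, Matrix.mul_sub, Matrix.mul_assoc,
      Matrix.mul_zero, Matrix.mul_smul, h.gram_left, hXU, ← hP] at this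
    simp only [← Matrix.mul_assoc Vᵀ, h.gram_right, hVD, ← hS] at this
    rw [Matrix.mul_assoc _ Uᵀ X, ← hP] at this
    have := congrFun₂ this a b
    simp only [Matrix.add_apply, Matrix.sub_apply, Matrix.smul_apply, mul_diagonal, diagonal_mul, transpose_apply,
      Matrix.zero_apply, smul_eq_mul] at this
    linarith
  have e3 : ∀ a b, P b a + S b a = P a b + S a b := fun a b => congrFun₂ hsym a b
  -- Adding the equations and using symmetry gives `(P + S) a b * (g a + g b) = 0`; if `g a + g b =
  -- 0`, the `a`-th columns of `U` and `V` are zero.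
  have hsum : ∀ a b, P a b + S a b = 0 := fun a b => by
    have hga := h.nonneg a
    have hgb := h.nonneg b
    have h1 : (P a b + S a b) * (g a + g b) = 0 := by
      linear_combination e1 a b + e2 a b - g a * e3 a b
    rcases mul_eq_zero.mp h1 with h1 | h1
    · exact h1
    · have h2 : g a = 0 := by linarith
      change Uᵀ a ⬝ᵥ Xᵀ b + Vᵀ a ⬝ᵥ Yᵀ b = 0
      rw [h.left_eq_zero h2, h.right_eq_zero h2, zero_dotProduct, zero_dotProduct, add_zero]
  have hP0 : P = 0 := by
    ext a b
    have hga := h.nonneg a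
    have hgb := h.nonneg b
    have s1 := hsum a b
    have s2 := hsum b a
    have f1 : P a b * g b - g a * P b a + 2 * lam * P a b = 0 := by
      linear_combination e1 a b - g a * s2 + lam * s1
    have f2 : P b a * g a - g b * P a b + 2 * lam * P b a = 0 := by
      linear_combination e1 b a - g b * s1 + lam * s2
    have f3 : P b a = -P a b := by
      have : 2 * lam * (P a b + P b a) = 0 := by linear_combination f1 + f2
      have := (mul_eq_zero.mp this).resolve_left (by positivity)
      linarith
    have f4 : P a b * (g a + g b + 2 * lam) = 0 := by
      linear_combination f1 + g a * f3
    exact (mul_eq_zero.mp f4).resolve_right (by positivity)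
  have hS0 : S = 0 := by
    ext a b
    have := hsum a b
    rw [hP0] at this
    simpa using this
  have hgX : X * (diagonal fun a => lam + g a) = D * Y := by
    simp only [Matrix.add_mul, Matrix.sub_mul, Matrix.mul_assoc, h.gram_right, hYV, ← hS, hS0,
      transpose_zero, Matrix.mul_zero] at hX
    rw [diagonal_const_add, Matrix.mul_add, Matrix.mul_smul, Matrix.mul_one, ← sub_eq_zero, ← hX]
    abel
  have hgY : Y * (diagonal fun a => lam + g a) = Dᵀ * X := by
    simp only [transpose_add, transpose_sub, transpose_mul, transpose_transpose,
      Matrix.add_mul, Matrix.sub_mul, Matrix.mul_assoc, h.gram_left, hXU, ← hP, hP0,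
      transpose_zero, Matrix.mul_zero] at hY
    rw [diagonal_const_add, Matrix.mul_add, Matrix.mul_smul, Matrix.mul_one, ← sub_eq_zero, ← hY]
    abel
  -- A nonzero column of `Y` would be orthogonal to the columns of `V` and an eigenvector of `DᵀD`
  -- for `(lam + g a) ^ 2`, which `hlt` forbids.
  have hY0 : Y = 0 := by
    suffices ∀ a, Yᵀ a = 0 by
      ext j a
      exact congrFun (this a) j
    intro a
    by_contra h0
    have c1 : D *ᵥ Yᵀ a = (lam + g a) • Xᵀ a := by
      ext i
      have := congrFun₂ hgX i a
      rw [mul_diagonal, mul_comm] at this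
      exact this.symm
    have c2 : Dᵀ *ᵥ Xᵀ a = (lam + g a) • Yᵀ a := by
      ext i
      have := congrFun₂ hgY i a
      rw [mul_diagonal, mul_comm] at this
      exact this.symm
    have c3 := hlt a (Yᵀ a) h0 (by ext b; exact congrFun₂ hS0 b a)
    rw [← mulVec_mulVec, c1, mulVec_smul, c2, dotProduct_smul, dotProduct_smul, smul_eq_mul,
      smul_eq_mul, ← mul_assoc, ← sq] at c3
    exact lt_irrefl _ c3
  refine ⟨?_, hY0⟩
  ext i a
  have := congrFun₂ hgX i a
  rw [hY0, Matrix.mul_zero, mul_diagonal, Matrix.zero_apply] at this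
  have hga := h.nonneg a
  exact (mul_eq_zero.mp this).resolve_right (by positivity)

end

/-! ### The objective on the Euclidean space of pairs -/

section

open scoped Matrix.Norms.Frobenius

theorem frobSq_eq_norm_sq {a b : ℕ} (A : Matrix (Fin a) (Fin b) ℝ) : frobSq A = ‖A‖ ^ 2 := by
  rw [frobenius_norm_def, ← Real.sqrt_eq_rpow, Real.sq_sqrt (by positivity)]
  simp [frobSq]

theorem abs_trace_transpose_mul_le {a b : ℕ} (A B : Matrix (Fin a) (Fin b) ℝ) :
    |(Aᵀ * B).trace| ≤ ‖A‖ * ‖B‖ := by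
  refine abs_le_of_sq_le_sq ?_ (by positivity)
  rw [mul_pow, ← frobSq_eq_norm_sq, ← frobSq_eq_norm_sq]
  have h1 : (Aᵀ * B).trace = ∑ p : Fin a × Fin b, A p.1 p.2 * B p.1 p.2 := by
    rw [Fintype.sum_prod_type, Finset.sum_comm]
    rfl
  have h2 : ∀ C : Matrix (Fin a) (Fin b) ℝ, frobSq C = ∑ p : Fin a × Fin b, C p.1 p.2 ^ 2 :=
    fun C => by
      rw [Fintype.sum_prod_type]
      rfl
  rw [h1, h2, h2]
  exact Finset.sum_mul_sq_le_sq_mul_sq _ _ _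

end

section

variable {n m r : ℕ}

/-- The pair `(U, V)` as an element of the Euclidean space of pairs. -/
def mkPair (U : Matrix (Fin n) (Fin r) ℝ) (V : Matrix (Fin m) (Fin r) ℝ) : FactorSpace n m r :=
  WithLp.toLp 2 (WithLp.toLp 2 fun i => U i.1 i.2, WithLp.toLp 2 fun j => V j.1 j.2)

@[simp] theorem facU_mkPair (U : Matrix (Fin n) (Fin r) ℝ) (V : Matrix (Fin m) (Fin r) ℝ) :
    facU (mkPair U V) = U := rfl

@[simp] theorem facV_mkPair (U : Matrix (Fin n) (Fin r) ℝ) (V : Matrix (Fin m) (Fin r) ℝ) :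
    facV (mkPair U V) = V := rfl

@[simp] theorem mkPair_facU_facV (p : FactorSpace n m r) : mkPair (facU p) (facV p) = p := rfl

@[simp] theorem facU_add (p q : FactorSpace n m r) : facU (p + q) = facU p + facU q := rfl

@[simp] theorem facV_add (p q : FactorSpace n m r) : facV (p + q) = facV p + facV q := rfl

@[simp] theorem facU_sub (p q : FactorSpace n m r) : facU (p - q) = facU p - facU q := rfl

@[simp] theorem facV_sub (p q : FactorSpace n m r) : facV (p - q) = facV p - facV q := rfl

@[simp] theorem facU_smul (c : ℝ) (p : FactorSpace n m r) : facU (c • p) = c • facU p := rfl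

@[simp] theorem facV_smul (c : ℝ) (p : FactorSpace n m r) : facV (c • p) = c • facV p := rfl

theorem factorSpace_ext {p q : FactorSpace n m r} (hU : facU p = facU q) (hV : facV p = facV q) :
    p = q := by
  rw [← mkPair_facU_facV p, ← mkPair_facU_facV q, hU, hV]

theorem Phi_mkPair (D : Matrix (Fin n) (Fin m) ℝ) (lam : ℝ) (U : Matrix (Fin n) (Fin r) ℝ)
    (V : Matrix (Fin m) (Fin r) ℝ) : Phi D lam (mkPair U V) = factorObj D lam U V := rfl

theorem Phi_eq_factorObj (D : Matrix (Fin n) (Fin m) ℝ) (lam : ℝ) (p : FactorSpace n m r) :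
    Phi D lam p = factorObj D lam (facU p) (facV p) := rfl

theorem factorSpace_norm_sq (p : FactorSpace n m r) :
    ‖p‖ ^ 2 = frobSq (facU p) + frobSq (facV p) := by
  rw [WithLp.prod_norm_sq_eq_of_L2, EuclideanSpace.real_norm_sq_eq, EuclideanSpace.real_norm_sq_eq,
    Fintype.sum_prod_type, Fintype.sum_prod_type]
  rfl

theorem factorSpace_inner (p q : FactorSpace n m r) :
    inner ℝ p q = ((facU p)ᵀ * facU q).trace + ((facV p)ᵀ * facV q).trace := by
  have h : ∀ {N : ℕ} (A B : Matrix (Fin N) (Fin r) ℝ),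
      (Aᵀ * B).trace = ∑ i : Fin N × Fin r, B i.1 i.2 * A i.1 i.2 := fun A B => by
    rw [Fintype.sum_prod_type, Finset.sum_comm]
    simp [trace, mul_apply, mul_comm]
  rw [WithLp.prod_inner_apply, h, h]
  rfl

/-- The gradient of the objective. -/
def gradPhi (D : Matrix (Fin n) (Fin m) ℝ) (lam : ℝ) (p : FactorSpace n m r) :
    FactorSpace n m r :=
  mkPair ((facU p * (facV p)ᵀ - D) * facV p + lam • facU p)
    ((facU p * (facV p)ᵀ - D)ᵀ * facU p + lam • facV p)

theorem isCriticalPair_of_gradPhi_eq_zero {D : Matrix (Fin n) (Fin m) ℝ} {lam : ℝ}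
    {p : FactorSpace n m r} (h : gradPhi D lam p = 0) :
    IsCriticalPair D lam (facU p) (facV p) :=
  ⟨congrArg facU h, congrArg facV h⟩

/-- The Hessian of the objective. -/
def hessPhi (D : Matrix (Fin n) (Fin m) ℝ) (lam : ℝ) (p : FactorSpace n m r) :
    FactorSpace n m r →ₗ[ℝ] FactorSpace n m r where
  toFun d := mkPair
    ((facU d * (facV p)ᵀ + facU p * (facV d)ᵀ) * facV p + (facU p * (facV p)ᵀ - D) * facV d
      + lam • facU d)
    ((facU d * (facV p)ᵀ + facU p * (facV d)ᵀ)ᵀ * facU p + (facU p * (facV p)ᵀ - D)ᵀ * facU d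
      + lam • facV d)
  map_add' d e := by
    apply factorSpace_ext <;>
    · simp only [facU_mkPair, facV_mkPair, facU_add, facV_add, transpose_add, transpose_mul,
        transpose_transpose, Matrix.add_mul, Matrix.mul_add, smul_add]
      abel
  map_smul' c d := by
    apply factorSpace_ext <;>
    simp only [facU_mkPair, facV_mkPair, facU_smul, facV_smul, transpose_smul, transpose_add,
        transpose_mul, transpose_transpose, Matrix.add_mul, smul_add, Matrix.smul_mul,
        Matrix.mul_smul, RingHom.id_apply, smul_comm lam c]

/-- The objective is a polynomial, so the expansion is exact. Every term in the last bracket is at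
least quadratic in `d`, which yields both the gradient and the quadratic bound on the excess. -/
theorem Phi_add_eq (D : Matrix (Fin n) (Fin m) ℝ) (lam : ℝ) (p d : FactorSpace n m r) :
    Phi D lam (p + d) = Phi D lam p + inner ℝ (gradPhi D lam p) d
      + (1 / 2 * frobSq (facU d * (facV p)ᵀ + facU p * (facV d)ᵀ + facU d * (facV d)ᵀ)
        + ((facU p * (facV p)ᵀ - D)ᵀ * (facU d * (facV d)ᵀ)).trace + lam / 2 * ‖d‖ ^ 2) := by
  have hadd : ∀ {a b : ℕ} (A B : Matrix (Fin a) (Fin b) ℝ),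
      frobSq (A + B) = frobSq A + 2 * (Aᵀ * B).trace + frobSq B := fun A B => by
    have : (Bᵀ * A).trace = (Aᵀ * B).trace := by
      rw [← trace_transpose, transpose_mul, transpose_transpose]
    simp only [frobSq_eq_trace, transpose_add, Matrix.add_mul, Matrix.mul_add, trace_add, this]
    ring
  rw [factorSpace_inner, factorSpace_norm_sq]
  simp only [Phi, gradPhi, facU_mkPair, facV_mkPair, facU_add, facV_add]
  set U := facU p
  set V := facV p
  set X := facU d
  set Y := facV d
  set B := U * Vᵀ - D
  have e : (U + X) * (V + Y)ᵀ - D = B + (X * Vᵀ + U * Yᵀ + X * Yᵀ) := by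
    simp only [B, transpose_add, Matrix.add_mul, Matrix.mul_add]
    abel
  rw [e, hadd, hadd U, hadd V]
  have t1 : ((B * V + lam • U)ᵀ * X).trace = (Bᵀ * (X * Vᵀ)).trace + lam * (Uᵀ * X).trace := by
    rw [transpose_add, transpose_mul, transpose_smul, Matrix.add_mul, trace_add, Matrix.smul_mul,
      trace_smul, smul_eq_mul, Matrix.mul_assoc, trace_mul_comm, Matrix.mul_assoc]
  have t2 : ((Bᵀ * U + lam • V)ᵀ * Y).trace = (Bᵀ * (U * Yᵀ)).trace + lam * (Vᵀ * Y).trace := by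
    rw [transpose_add, transpose_mul, transpose_smul, Matrix.add_mul, trace_add, Matrix.smul_mul,
      trace_smul, smul_eq_mul, transpose_transpose, ← trace_transpose (Bᵀ * _)]
    simp only [transpose_mul, transpose_transpose]
    rw [Matrix.mul_assoc, trace_mul_comm, Matrix.mul_assoc, trace_mul_comm]
  rw [t1, t2]
  simp only [Matrix.mul_add, trace_add]
  ring

section

open scoped Matrix.Norms.Frobenius

theorem norm_facU_le (p : FactorSpace n m r) : ‖facU p‖ ≤ ‖p‖ := by
  refine le_of_sq_le_sq ?_ (norm_nonneg _)
  rw [factorSpace_norm_sq, ← frobSq_eq_norm_sq]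
  linarith [frobSq_nonneg (facV p)]

theorem norm_facV_le (p : FactorSpace n m r) : ‖facV p‖ ≤ ‖p‖ := by
  refine le_of_sq_le_sq ?_ (norm_nonneg _)
  rw [factorSpace_norm_sq, ← frobSq_eq_norm_sq]
  linarith [frobSq_nonneg (facU p)]

theorem norm_mkPair_le (U : Matrix (Fin n) (Fin r) ℝ) (V : Matrix (Fin m) (Fin r) ℝ) :
    ‖mkPair U V‖ ≤ ‖U‖ + ‖V‖ := by
  refine le_of_sq_le_sq ?_ (by positivity)
  rw [factorSpace_norm_sq, facU_mkPair, facV_mkPair, frobSq_eq_norm_sq, frobSq_eq_norm_sq]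
  nlinarith [norm_nonneg U, norm_nonneg V]

theorem norm_mul_transpose_le {a b c : ℕ} {A : Matrix (Fin a) (Fin b) ℝ}
    {B : Matrix (Fin c) (Fin b) ℝ} {x y : ℝ} (hA : ‖A‖ ≤ x) (hB : ‖B‖ ≤ y) : ‖A * Bᵀ‖ ≤ x * y :=
  (frobenius_norm_mul _ _).trans (by
    rw [frobenius_norm_transpose]
    exact mul_le_mul hA hB (norm_nonneg _) ((norm_nonneg _).trans hA))

theorem exists_abs_Phi_sub_le (D : Matrix (Fin n) (Fin m) ℝ) (lam : ℝ) (p : FactorSpace n m r) :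
    ∃ C, 0 ≤ C ∧ ∀ d, ‖d‖ ≤ 1 →
      |Phi D lam (p + d) - Phi D lam p - inner ℝ (gradPhi D lam p) d| ≤ C * ‖d‖ ^ 2 := by
  refine ⟨1 / 2 * (2 * ‖p‖ + 1) ^ 2 + ‖facU p * (facV p)ᵀ - D‖ + |lam| / 2, by positivity,
    fun d hd => ?_⟩
  rw [Phi_add_eq, add_sub_right_comm, add_sub_right_comm, add_sub_cancel_left, sub_self, zero_add]
  have hd0 := norm_nonneg d
  have hp0 := norm_nonneg p
  have hXY := norm_mul_transpose_le (norm_facU_le d) (norm_facV_le d)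
  have h1 : ‖facU d * (facV p)ᵀ + facU p * (facV d)ᵀ + facU d * (facV d)ᵀ‖ ≤
      (2 * ‖p‖ + 1) * ‖d‖ := by
    refine (norm_add₃_le).trans ?_
    have a1 := norm_mul_transpose_le (norm_facU_le d) (norm_facV_le p)
    have a2 := norm_mul_transpose_le (norm_facU_le p) (norm_facV_le d)
    nlinarith
  have h2 := abs_trace_transpose_mul_le (facU p * (facV p)ᵀ - D) (facU d * (facV d)ᵀ)
  have h3 : ‖facU p * (facV p)ᵀ - D‖ * ‖facU d * (facV d)ᵀ‖ ≤
      ‖facU p * (facV p)ᵀ - D‖ * ‖d‖ ^ 2 :=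
    mul_le_mul_of_nonneg_left (by rw [sq]; exact hXY) (norm_nonneg _)
  have h4 := pow_le_pow_left₀ (norm_nonneg _) h1 2
  rw [frobSq_eq_norm_sq]
  refine (abs_add_three _ _ _).trans ?_
  rw [abs_of_nonneg (a := 1 / 2 * _) (by positivity), abs_mul, abs_div,
    abs_of_nonneg (sq_nonneg ‖d‖), abs_of_pos (zero_lt_two (α := ℝ))]
  rw [mul_pow] at h4
  nlinarith

theorem hasGradientAt_Phi (D : Matrix (Fin n) (Fin m) ℝ) (lam : ℝ) (p : FactorSpace n m r) :
    HasGradientAt (Phi D lam) (gradPhi D lam p) p := by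
  obtain ⟨C, hC, h⟩ := exists_abs_Phi_sub_le D lam p
  rw [hasGradientAt_iff_isLittleO_nhds_zero]
  have h1 : (fun d : FactorSpace n m r => ‖d‖ ^ 2) =o[𝓝 0] fun d => d := by
    simpa using (Asymptotics.isLittleO_norm_pow_id (E' := FactorSpace n m r) one_lt_two)
  refine Asymptotics.IsBigO.trans_isLittleO ?_ h1
  refine Asymptotics.IsBigO.of_bound C ?_
  filter_upwards [Metric.closedBall_mem_nhds (0 : FactorSpace n m r) one_pos] with d hd
  rw [mem_closedBall_zero_iff] at hd
  simpa using h d hd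

theorem gradient_Phi (D : Matrix (Fin n) (Fin m) ℝ) (lam : ℝ) (p : FactorSpace n m r) :
    gradient (Phi D lam) p = gradPhi D lam p :=
  (hasGradientAt_Phi D lam p).gradient

theorem exists_norm_gradPhi_sub_le (D : Matrix (Fin n) (Fin m) ℝ) (lam : ℝ)
    (p : FactorSpace n m r) :
    ∃ C, 0 < C ∧ ∀ d, ‖d‖ ≤ 1 →
      ‖gradPhi D lam (p + d) - gradPhi D lam p - hessPhi D lam p d‖ ≤ C * ‖d‖ ^ 2 := by
  refine ⟨2 * (3 * ‖p‖ + 1), by positivity, fun d hd => ?_⟩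
  have hd0 := norm_nonneg d
  have hp0 := norm_nonneg p
  have hE : ‖facU d * (facV p)ᵀ + facU p * (facV d)ᵀ‖ ≤ 2 * ‖p‖ * ‖d‖ := by
    refine (norm_add_le _ _).trans ?_
    have a1 := norm_mul_transpose_le (norm_facU_le d) (norm_facV_le p)
    have a2 := norm_mul_transpose_le (norm_facU_le p) (norm_facV_le d)
    nlinarith
  have hF := norm_mul_transpose_le (norm_facU_le d) (norm_facV_le d)
  have e : gradPhi D lam (p + d) - gradPhi D lam p - hessPhi D lam p d = mkPair
      ((facU d * (facV p)ᵀ + facU p * (facV d)ᵀ) * facV d + (facU d * (facV d)ᵀ) * facV p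
        + (facU d * (facV d)ᵀ) * facV d)
      ((facU d * (facV p)ᵀ + facU p * (facV d)ᵀ)ᵀ * facU d + (facU d * (facV d)ᵀ)ᵀ * facU p
        + (facU d * (facV d)ᵀ)ᵀ * facU d) := by
    apply factorSpace_ext <;>
    · simp only [gradPhi, hessPhi, LinearMap.coe_mk, AddHom.coe_mk, facU_sub, facV_sub, facU_mkPair,
        facV_mkPair, facU_add, facV_add, transpose_add, transpose_sub, transpose_mul,
        transpose_transpose, Matrix.add_mul, Matrix.sub_mul, Matrix.mul_add, smul_add]
      abel
  rw [e]
  have hbound : ∀ {a c : ℕ} {E F : Matrix (Fin a) (Fin c) ℝ} {P X : Matrix (Fin c) (Fin r) ℝ},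
      ‖E‖ ≤ 2 * ‖p‖ * ‖d‖ → ‖F‖ ≤ ‖d‖ * ‖d‖ → ‖P‖ ≤ ‖p‖ → ‖X‖ ≤ ‖d‖ →
      ‖E * X + F * P + F * X‖ ≤ (3 * ‖p‖ + 1) * ‖d‖ ^ 2 := by
    intro a c E F P X hE hF hP hX
    refine (norm_add₃_le).trans ?_
    have a1 := (frobenius_norm_mul E X).trans (mul_le_mul hE hX (norm_nonneg _) (by positivity))
    have a2 := (frobenius_norm_mul F P).trans (mul_le_mul hF hP (norm_nonneg _) (by positivity))
    have a3 := (frobenius_norm_mul F X).trans (mul_le_mul hF hX (norm_nonneg _) (by positivity))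
    have a4 : ‖d‖ * ‖d‖ * ‖d‖ ≤ ‖d‖ ^ 2 := by nlinarith [mul_nonneg hd0 hd0]
    nlinarith
  refine (norm_mkPair_le _ _).trans ?_
  have b1 := hbound hE hF (norm_facV_le p) (norm_facV_le d)
  have b2 := hbound (by rwa [frobenius_norm_transpose]) (by rwa [frobenius_norm_transpose])
    (norm_facU_le p) (norm_facU_le d) (E := (facU d * (facV p)ᵀ + facU p * (facV d)ᵀ)ᵀ)
    (F := (facU d * (facV d)ᵀ)ᵀ)
  linarith

/-- Orthogonal Procrustes problem: a trace maximizing rotation makes the matrix symmetric. -/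
theorem exists_orthogonal_trace_max (K : Matrix (Fin r) (Fin r) ℝ) :
    ∃ R : Matrix (Fin r) (Fin r) ℝ, Rᵀ * R = 1 ∧
      (∀ R' : Matrix (Fin r) (Fin r) ℝ, R'ᵀ * R' = 1 → (K * R').trace ≤ (K * R).trace) ∧
      (K * R)ᵀ = K * R := by
  let O : Set (Matrix (Fin r) (Fin r) ℝ) := {R | Rᵀ * R = 1}
  have hclosed : IsClosed O := isClosed_eq (by fun_prop) continuous_const
  have hcomp : IsCompact O := by
    refine (isCompact_closedBall (0 : Matrix (Fin r) (Fin r) ℝ) (√r)).of_isClosed_subset hclosed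
      fun R hR => ?_
    rw [mem_closedBall_zero_iff]
    refine Real.le_sqrt_of_sq_le ?_
    rw [← frobSq_eq_norm_sq, frobSq_eq_trace, show Rᵀ * R = 1 from hR, trace_one,
      Fintype.card_fin]
  obtain ⟨R, hR, hmax⟩ := hcomp.exists_isMaxOn ⟨1, by simp [O]⟩
    (f := fun R => (K * R).trace) (Continuous.continuousOn (by fun_prop))
  refine ⟨R, hR, fun R' hR' => hmax hR', ?_⟩
  set S := K * R with hS
  have hskew : (S * (Sᵀ - S)).trace = 0 := by
    -- Exponentials of skew matrices are orthogonal, so this varies the maximizer within the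
    -- rotations and has a maximum at `0`.
    let f : ℝ → ℝ := fun t => (S * NormedSpace.exp (t • (Sᵀ - S))).trace
    have hmax' : IsLocalMax f 0 := by
      refine Eventually.of_forall fun t => ?_
      have hcomm : Commute (-(t • (Sᵀ - S))) (t • (Sᵀ - S)) :=
        (Commute.refl (t • (Sᵀ - S))).neg_left
      have hort : (R * NormedSpace.exp (t • (Sᵀ - S)))ᵀ *
          (R * NormedSpace.exp (t • (Sᵀ - S))) = 1 := by
        rw [transpose_mul, Matrix.mul_assoc, ← Matrix.mul_assoc Rᵀ, show Rᵀ * R = 1 from hR,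
          Matrix.one_mul, ← Matrix.exp_transpose,
          show (t • (Sᵀ - S))ᵀ = -(t • (Sᵀ - S)) by
            rw [transpose_smul, transpose_sub, transpose_transpose, ← smul_neg, neg_sub],
          ← Matrix.exp_add_of_commute _ _ hcomm, neg_add_cancel,
          NormedSpace.exp_zero]
      have := hmax hort
      simpa [f, hS, Matrix.mul_assoc] using this
    have hder : HasDerivAt f (S * (Sᵀ - S)).trace 0 := by
      have h1 := hasDerivAt_exp_smul_const (𝕂 := ℝ) (Sᵀ - S) (0 : ℝ)
      rw [zero_smul, NormedSpace.exp_zero, one_mul] at h1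
      let L : Matrix (Fin r) (Fin r) ℝ →ₗ[ℝ] ℝ :=
        (traceLinearMap (Fin r) ℝ ℝ) ∘ₗ LinearMap.mulLeft ℝ S
      exact (LinearMap.toContinuousLinearMap L).hasFDerivAt.comp_hasDerivAt (0 : ℝ) h1
    exact hmax'.hasDerivAt_eq_zero hder
  -- `‖Sᵀ - S‖²` is twice the vanishing trace.
  have hz : frobSq (Sᵀ - S) = 0 := by
    have h1 : (Sᵀ * Sᵀ).trace = (S * S).trace := by
      rw [← trace_transpose, transpose_mul, transpose_transpose]
    have h2 : (Sᵀ * S).trace = (S * Sᵀ).trace := trace_mul_comm _ _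
    rw [frobSq_eq_trace, transpose_sub, transpose_transpose, Matrix.sub_mul, trace_sub, hskew,
      Matrix.mul_sub, trace_sub, h1, h2, ← trace_sub, ← Matrix.mul_sub]
    rw [← neg_sub, Matrix.mul_neg, trace_neg] at hskew
    linarith
  rw [frobSq_eq_norm_sq, sq_eq_zero_iff, norm_eq_zero, sub_eq_zero] at hz
  exact hz

end

theorem continuousAt_of_norm_sub_le {E F : Type*} [NormedAddCommGroup E] [NormedSpace ℝ E]
    [FiniteDimensional ℝ E] [NormedAddCommGroup F] [NormedSpace ℝ F] {g : E → F} {p : E}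
    (H : E →ₗ[ℝ] F) {C : ℝ} (h : ∀ d, ‖d‖ ≤ 1 → ‖g (p + d) - g p - H d‖ ≤ C * ‖d‖ ^ 2) :
    ContinuousAt g p := by
  have hH : Continuous H := H.continuous_of_finiteDimensional
  rw [ContinuousAt, tendsto_iff_norm_sub_tendsto_zero]
  have hlim : Tendsto (fun q => C * ‖q - p‖ ^ 2 + ‖H (q - p)‖) (𝓝 p) (𝓝 0) := by
    have : Continuous fun q => C * ‖q - p‖ ^ 2 + ‖H (q - p)‖ := by fun_prop
    simpa using this.tendsto p
  refine squeeze_zero' (Eventually.of_forall fun _ => norm_nonneg _) ?_ hlim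
  filter_upwards [Metric.closedBall_mem_nhds p one_pos] with q hq
  have h1 := h (q - p) (by simpa [dist_eq_norm] using hq)
  rw [add_sub_cancel] at h1
  have h2 := norm_add_le (g q - g p - H (q - p)) (H (q - p))
  rw [sub_add_cancel] at h2
  linarith

theorem continuous_gradPhi (D : Matrix (Fin n) (Fin m) ℝ) (lam : ℝ) :
    Continuous (gradPhi (r := r) D lam) :=
  continuous_iff_continuousAt.mpr fun p =>
    let ⟨_, _, h⟩ := exists_norm_gradPhi_sub_le D lam p
    continuousAt_of_norm_sub_le _ h

/-- Right multiplication of both components by a matrix. -/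
def rotate (R : Matrix (Fin r) (Fin r) ℝ) (p : FactorSpace n m r) : FactorSpace n m r :=
  mkPair (facU p * R) (facV p * R)

theorem rotate_sub (R : Matrix (Fin r) (Fin r) ℝ) (p q : FactorSpace n m r) :
    rotate R p - rotate R q = rotate R (p - q) := by
  apply factorSpace_ext <;> simp [rotate, Matrix.sub_mul]

theorem norm_rotate {R : Matrix (Fin r) (Fin r) ℝ} (hR : Rᵀ * R = 1) (p : FactorSpace n m r) :
    ‖rotate R p‖ = ‖p‖ := by
  rw [← sq_eq_sq₀ (norm_nonneg _) (norm_nonneg _), factorSpace_norm_sq, factorSpace_norm_sq]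
  simp only [rotate, facU_mkPair, facV_mkPair, frobSq_mul_of_orthogonal hR]

theorem Phi_rotate {R : Matrix (Fin r) (Fin r) ℝ} (hR : Rᵀ * R = 1) (D : Matrix (Fin n) (Fin m) ℝ)
    (lam : ℝ) (p : FactorSpace n m r) : Phi D lam (rotate R p) = Phi D lam p := by
  rw [rotate, Phi_mkPair, factorObj_mul_of_orthogonal hR, Phi_eq_factorObj]

theorem gradPhi_rotate {R : Matrix (Fin r) (Fin r) ℝ} (hR : Rᵀ * R = 1)
    (D : Matrix (Fin n) (Fin m) ℝ) (lam : ℝ) (p : FactorSpace n m r) :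
    gradPhi D lam (rotate R p) = rotate R (gradPhi D lam p) := by
  apply factorSpace_ext <;>
  simp only [rotate, gradPhi, facU_mkPair, facV_mkPair, mul_mul_transpose_of_orthogonal hR,
    Matrix.add_mul, Matrix.smul_mul, Matrix.mul_assoc]

/-- Best rotational alignment of `p` with `q`. -/
theorem exists_rotate_align (p q : FactorSpace n m r) :
    ∃ R : Matrix (Fin r) (Fin r) ℝ, Rᵀ * R = 1 ∧
      (∀ R' : Matrix (Fin r) (Fin r) ℝ, R'ᵀ * R' = 1 →
        ‖rotate R p - q‖ ≤ ‖rotate R' p - q‖) ∧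
      ((facU q)ᵀ * facU (rotate R p - q) + (facV q)ᵀ * facV (rotate R p - q))ᵀ =
        (facU q)ᵀ * facU (rotate R p - q) + (facV q)ᵀ * facV (rotate R p - q) := by
  obtain ⟨R, hR, hmax, hsym⟩ :=
    exists_orthogonal_trace_max ((facU q)ᵀ * facU p + (facV q)ᵀ * facV p)
  -- Rotations preserve norms, so the nearest rotated copy is the one maximizing this trace.
  have hin : ∀ R', inner ℝ (rotate R' p) q =
      (((facU q)ᵀ * facU p + (facV q)ᵀ * facV p) * R').trace := fun R' => by
    rw [real_inner_comm, factorSpace_inner]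
    simp only [rotate, facU_mkPair, facV_mkPair, Matrix.add_mul, trace_add, Matrix.mul_assoc]
  refine ⟨R, hR, fun R' hR' => ?_, ?_⟩
  · rw [← sq_le_sq₀ (norm_nonneg _) (norm_nonneg _), norm_sub_sq_real, norm_sub_sq_real,
      norm_rotate hR, norm_rotate hR', hin, hin]
    linarith [hmax R' hR']
  · have e : (facU q)ᵀ * facU (rotate R p - q) + (facV q)ᵀ * facV (rotate R p - q) =
        ((facU q)ᵀ * facU p + (facV q)ᵀ * facV p) * R -
          ((facU q)ᵀ * facU q + (facV q)ᵀ * facV q) := by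
      simp only [rotate, facU_sub, facV_sub, facU_mkPair, facV_mkPair, Matrix.mul_sub,
        Matrix.add_mul, Matrix.mul_assoc]
      abel
    rw [e, transpose_sub, hsym, transpose_add, transpose_mul, transpose_mul, transpose_transpose,
      transpose_transpose]

end

/-! ### Subdifferentials of continuously differentiable functions -/

section

variable {E : Type*} [NormedAddCommGroup E] [InnerProductSpace ℝ E]

theorem regularSubdiff_eq_singleton [CompleteSpace E] {h : E → ℝ} {x v : E}
    (hv : HasGradientAt h v x) : regularSubdiff h x = {v} := by
  rw [hasGradientAt_iff_isLittleO] at hv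
  ext w
  rw [mem_singleton_iff]
  constructor
  · intro hw
    by_contra hne
    have hpos : 0 < ‖w - v‖ := norm_pos_iff.mpr (sub_ne_zero.mpr hne)
    -- Along the ray in direction `w - v` the two error terms add up to two thirds of the gap that
    -- they would have to cover.
    have hε : 0 < ‖w - v‖ / 3 := by positivity
    have h1 := hw _ hε
    have h2 := hv.def hε
    have hlim : Tendsto (fun t : ℝ => x + t • (w - v)) (𝓝[>] 0) (𝓝 x) := by
      have : Continuous fun t : ℝ => x + t • (w - v) := by fun_prop
      have h0 := this.tendsto 0
      rw [zero_smul, add_zero] at h0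
      exact h0.mono_left nhdsWithin_le_nhds
    obtain ⟨t, ⟨h3, h4⟩, ht⟩ := ((hlim.eventually (h1.and h2)).and self_mem_nhdsWithin).exists
    have ht : 0 < t := ht
    rw [add_sub_cancel_left, norm_smul, Real.norm_of_nonneg ht.le] at h3 h4
    have h5 := (abs_le.mp h4).2
    rw [inner_smul_right] at h3 h5
    have h6 : inner ℝ w (w - v) - inner ℝ v (w - v) = ‖w - v‖ ^ 2 := by
      rw [← inner_sub_left, real_inner_self_eq_norm_sq]
    have h7 : t * ‖w - v‖ ^ 2 ≤ 2 * (‖w - v‖ / 3 * (t * ‖w - v‖)) := by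
      rw [← h6]
      linarith
    have h8 : 0 < t * ‖w - v‖ ^ 2 := by positivity
    linarith
  · rintro rfl ε hε
    filter_upwards [hv.def hε] with y hy
    have := (abs_le.mp hy).1
    linarith

theorem limitingSubdiff_eq_singleton [CompleteSpace E] {h : E → ℝ} {g : E → E}
    (hg : ∀ x, HasGradientAt h (g x) x) (hc : Continuous g) (x : E) :
    limitingSubdiff h x = {g x} := by
  ext v
  rw [mem_singleton_iff]
  constructor
  · rintro ⟨y, w, hy, -, hw, hwv⟩
    have : w = g ∘ y := funext fun i => by simpa [regularSubdiff_eq_singleton (hg _)] using hw i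
    rw [this] at hwv
    exact tendsto_nhds_unique hwv ((hc.tendsto x).comp hy)
  · rintro rfl
    exact ⟨fun _ => x, fun _ => g x, tendsto_const_nhds, tendsto_const_nhds,
      fun _ => by simp [regularSubdiff_eq_singleton (hg _)], tendsto_const_nhds⟩

theorem hasDerivAt_const_mul_sqrt (c : ℝ) {s : ℝ} (hs : 0 < s) :
    HasDerivAt (fun s => c * √s) (c * (1 / (2 * √s))) s :=
  (Real.hasDerivAt_sqrt hs.ne').const_mul c

theorem isDesingularizing_const_mul_sqrt {c : ℝ} (hc : 0 < c) :
    IsDesingularizing ⊤ fun s => c * √s where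
  nonneg s _ _ := by positivity
  continuousOn := by fun_prop
  concaveOn := by
    have : {s : ℝ | 0 ≤ s ∧ (s : EReal) < ⊤} = Set.Ici 0 := by
      ext s
      simp [EReal.coe_lt_top]
    rw [this]
    exact Real.strictConcaveOn_sqrt.concaveOn.smul hc.le
  map_zero := by simp
  contDiffOn := contDiffOn_const.mul fun s hs =>
    (Real.contDiffAt_sqrt hs.1.ne').contDiffWithinAt
  deriv_pos s hs _ := by
    rw [(hasDerivAt_const_mul_sqrt c hs).deriv]
    have := Real.sqrt_pos.mpr hs
    positivity

/-- Local gradient domination gives the KL property of exponent `1/2`. -/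
theorem hasKLHalf_of_gradient_domination [CompleteSpace E] {h : E → ℝ} {g : E → E}
    (hg : ∀ x, HasGradientAt h (g x) x) (hc : Continuous g) {x₀ : E} {η : ℝ} (hη : 0 < η)
    (hdom : ∀ᶠ x in 𝓝 x₀, η * (h x - h x₀) ≤ ‖g x‖ ^ 2) : HasKLHalf h x₀ := by
  have hη' := Real.sqrt_pos.mpr hη
  -- With `c = 2 / √η` the KL product is `‖g x‖ / (√η √(h x - h x₀))`.
  refine ⟨2 / √η, by positivity, ?_, ⊤, EReal.zero_lt_top,
    isDesingularizing_const_mul_sqrt (by positivity), _, hdom, fun x hx hpos _ => ?_⟩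
  · rw [limitingSubdiff_eq_singleton hg hc]
    exact singleton_nonempty _
  have hx : η * (h x - h x₀) ≤ ‖g x‖ ^ 2 := hx
  rw [limitingSubdiff_eq_singleton hg hc, Metric.infEDist_singleton, edist_comm,
    edist_zero_right, ← ofReal_norm, ← ENNReal.ofReal_mul' (norm_nonneg _),
    ENNReal.one_le_ofReal, (hasDerivAt_const_mul_sqrt _ hpos).deriv]
  have hs := Real.sqrt_pos.mpr hpos
  have h1 : √η * √(h x - h x₀) ≤ ‖g x‖ := by
    rw [← Real.sqrt_mul hη.le]
    exact Real.sqrt_le_iff.mpr ⟨norm_nonneg _, hx⟩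
  rw [show 2 / √η * (1 / (2 * √(h x - h x₀))) * ‖g x‖ = ‖g x‖ / (√η * √(h x - h x₀)) by
    field_simp]
  exact (one_le_div (by positivity)).mpr h1

/-- A map with a first order expansion whose linear part is injective on the kernel of `S` is
bounded below on that kernel near a zero. -/
theorem exists_norm_le_of_injective {E F G : Type*} [NormedAddCommGroup E] [NormedSpace ℝ E]
    [FiniteDimensional ℝ E] [NormedAddCommGroup F] [NormedSpace ℝ F] [NormedAddCommGroup G]
    [NormedSpace ℝ G] {g : E → F} {p : E} (H : E →ₗ[ℝ] F) (S : E →ₗ[ℝ] G) {C : ℝ} (hC : 0 < C)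
    (h : ∀ d, ‖d‖ ≤ 1 → ‖g (p + d) - g p - H d‖ ≤ C * ‖d‖ ^ 2) (hgp : g p = 0)
    (hinj : ∀ d, H d = 0 → S d = 0 → d = 0) :
    ∃ c > 0, ∃ ε > 0, ∀ d, ‖d‖ ≤ ε → S d = 0 → c * ‖d‖ ≤ ‖g (p + d)‖ := by
  obtain ⟨K, hK, hanti⟩ := (H.prod S).exists_antilipschitzWith (by
    rw [LinearMap.ker_eq_bot']
    intro d hd
    exact hinj d (congrArg Prod.fst hd) (congrArg Prod.snd hd))
  have hK' : (0 : ℝ) < K := hK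
  -- The radius lets the quadratic error use up at most half of the linear lower bound `‖d‖ / K`.
  refine ⟨1 / (2 * K), by positivity, min 1 (1 / (2 * K * C)), by positivity, fun d hd hS => ?_⟩
  have hd1 : ‖d‖ ≤ 1 := hd.trans (min_le_left _ _)
  have hd2 : ‖d‖ ≤ 1 / (2 * K * C) := hd.trans (min_le_right _ _)
  have h1 : ‖d‖ ≤ K * ‖H d‖ := by
    have := hanti.le_mul_dist d 0
    simpa [dist_eq_norm, hS, Prod.norm_def] using this
  have h2 := h d hd1
  rw [hgp, sub_zero] at h2
  have h3 : ‖H d‖ - ‖g (p + d)‖ ≤ ‖g (p + d) - H d‖ := by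
    rw [norm_sub_rev]
    exact norm_sub_norm_le _ _
  have h4 : C * ‖d‖ ^ 2 ≤ 1 / (2 * K) * ‖d‖ := by
    have := mul_le_mul_of_nonneg_left hd2 (mul_nonneg hC.le (norm_nonneg d))
    calc C * ‖d‖ ^ 2 = C * ‖d‖ * ‖d‖ := by ring
      _ ≤ C * ‖d‖ * (1 / (2 * K * C)) := this
      _ = 1 / (2 * K) * ‖d‖ := by field_simp
  have h5 : 1 / K * ‖d‖ ≤ ‖H d‖ := by
    rw [one_div, inv_mul_le_iff₀ hK']
    exact h1
  have h6 : 1 / (2 * K) * ‖d‖ + 1 / (2 * K) * ‖d‖ = 1 / K * ‖d‖ := by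
    field_simp
    ring
  linarith

/-- Since `f ≥ 0`, a constant may be decreased, so finitely many local constants merge into their
minimum. -/
theorem exists_domination_of_isCompact {X : Type*} [TopologicalSpace X] {K : Set X}
    (hK : IsCompact K) {f g : X → ℝ} (hf : ∀ x, 0 ≤ f x)
    (hloc : ∀ x ∈ K, ∃ η > 0, ∀ᶠ y in 𝓝 x, η * f y ≤ g y) :
    ∃ η > 0, ∀ x ∈ K, η * f x ≤ g x := by
  refine hK.induction_on (p := fun s => ∃ η > 0, ∀ x ∈ s, η * f x ≤ g x)
    ⟨1, one_pos, by simp⟩ ?_ ?_ ?_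
  · rintro s t hst ⟨η, hη, h⟩
    exact ⟨η, hη, fun x hx => h x (hst hx)⟩
  · rintro s t ⟨η₁, h₁, hs⟩ ⟨η₂, h₂, ht⟩
    refine ⟨min η₁ η₂, lt_min h₁ h₂, fun x hx => ?_⟩
    rcases hx with hx | hx
    · exact (mul_le_mul_of_nonneg_right (min_le_left _ _) (hf x)).trans (hs x hx)
    · exact (mul_le_mul_of_nonneg_right (min_le_right _ _) (hf x)).trans (ht x hx)
  · intro x hx
    obtain ⟨η, hη, h⟩ := hloc x hx
    exact ⟨_, mem_nhdsWithin_of_mem_nhds h, η, hη, fun y hy => hy⟩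

end

/-! ### Gradient domination near the minimizers -/

section

variable {n m r : ℕ} {D : Matrix (Fin n) (Fin m) ℝ} {lam : ℝ} {Q : Matrix (Fin m) (Fin m) ℝ}
  {σ : ℕ → ℝ}

theorem gradPhi_eq_zero_of_mem {p : FactorSpace n m r} (hp : p ∈ globalMinimizers (Phi D lam)) :
    gradPhi D lam p = 0 := by
  have hmin : IsLocalMin (Phi D lam) p := Eventually.of_forall hp
  have := hmin.hasFDerivAt_eq_zero (hasGradientAt_Phi D lam p).hasFDerivAt
  simpa using this

theorem factorObj_le_of_mem {p : FactorSpace n m r} (hp : p ∈ globalMinimizers (Phi D lam))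
    (U : Matrix (Fin n) (Fin r) ℝ) (V : Matrix (Fin m) (Fin r) ℝ) :
    factorObj D lam (facU p) (facV p) ≤ factorObj D lam U V :=
  hp (mkPair U V)

/-- Deviation of `Uᵀ X + Vᵀ Y` from symmetry, as a linear function of `(X, Y)`. -/
def asymmetry (p : FactorSpace n m r) : FactorSpace n m r →ₗ[ℝ] (Fin r → Fin r → ℝ) where
  toFun d := fun a b => ((facU p)ᵀ * facU d + (facV p)ᵀ * facV d)ᵀ a b -
    ((facU p)ᵀ * facU d + (facV p)ᵀ * facV d) a b
  map_add' d e := by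
    ext a b
    simp only [facU_add, facV_add, Matrix.mul_add, Matrix.add_apply, transpose_apply, Pi.add_apply]
    ring
  map_smul' c d := by
    ext a b
    simp only [facU_smul, facV_smul, Matrix.mul_smul, Matrix.add_apply, transpose_apply,
      Matrix.smul_apply, Pi.smul_apply, smul_eq_mul, RingHom.id_apply]
    ring

theorem asymmetry_eq_zero_iff {p d : FactorSpace n m r} : asymmetry p d = 0 ↔
    ((facU p)ᵀ * facU d + (facV p)ᵀ * facV d)ᵀ = (facU p)ᵀ * facU d + (facV p)ᵀ * facV d := by
  rw [← sub_eq_zero (b := (facU p)ᵀ * facU d + (facV p)ᵀ * facV d)]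
  rfl

theorem exists_gradient_domination (hlam : 0 < lam) (hrm : r < m)
    (hS : IsSpectralDecomp (Dᵀ * D) Q fun j => σ j ^ 2) (hσ : ∀ i, 0 ≤ σ i)
    (hne : ∀ i < r, σ i ≠ lam) {l : Fin r} (hl : ∀ b, b ≤ l) (hgap : σ r < σ l)
    {p : FactorSpace n m r} (hp : p ∈ globalMinimizers (Phi D lam)) :
    ∃ η > 0, ∀ᶠ q in 𝓝 p, η * (Phi D lam q - Phi D lam p) ≤ ‖gradPhi D lam q‖ ^ 2 := by
  obtain ⟨R₀, γ, hR₀⟩ := exists_isSpectralDecomp_gram (facU p)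
  have hO := hR₀.orthogonal
  -- All expansions are taken at the diagonalized minimizer; rotation invariance carries the result
  -- back to `p`.
  set p₀ := rotate R₀ p with hp₀def
  have hp₀ : p₀ ∈ globalMinimizers (Phi (r := r) D lam) := fun q => by
    rw [Phi_rotate hO]
    exact hp q
  have hg₀ := gradPhi_eq_zero_of_mem hp₀
  have hdiag : IsDiagCriticalPair D lam (facU p₀) (facV p₀) γ :=
    (isCriticalPair_of_gradPhi_eq_zero
      (gradPhi_eq_zero_of_mem hp)).isDiag_of_isSpectralDecomp hlam.ne' hR₀
  obtain ⟨C₁, hC₁, hexp₁⟩ := exists_norm_gradPhi_sub_le D lam p₀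
  obtain ⟨C₂, hC₂, hexp₂⟩ := exists_abs_Phi_sub_le D lam p₀
  have hinj : ∀ d, hessPhi D lam p₀ d = 0 → asymmetry p₀ d = 0 → d = 0 := fun d hd hs => by
    have hlt : ∀ b, ∀ z ≠ 0, (facV p₀)ᵀ *ᵥ z = 0 →
        z ⬝ᵥ ((Dᵀ * D) *ᵥ z) < (lam + γ b) ^ 2 * (z ⬝ᵥ z) := fun b z hz hVz => by
      refine (hdiag.lt_of_isMin hlam hrm hS hσ hne hl hgap
        (factorObj_le_of_mem hp₀) hz hVz).trans_le ?_
      refine mul_le_mul_of_nonneg_right (pow_le_pow_left₀ ?_ ?_ 2) (dotProduct_self_pos hz).le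
      · linarith [hdiag.nonneg l]
      · linarith [hdiag.antitone (hl b)]
    obtain ⟨hX, hY⟩ := hdiag.hessian_injective hlam hlt
      (congrArg facU hd) (congrArg facV hd) (asymmetry_eq_zero_iff.mp hs)
    exact factorSpace_ext hX hY
  obtain ⟨c, hc, ε, hε, hlow⟩ :=
    exists_norm_le_of_injective (hessPhi D lam p₀) (asymmetry p₀) hC₁ hexp₁ hg₀ hinj
  refine ⟨c ^ 2 / (C₂ + 1), by positivity, ?_⟩
  filter_upwards [Metric.closedBall_mem_nhds p (lt_min hε one_pos)] with q hq
  obtain ⟨R, hR, hbest, hsym⟩ := exists_rotate_align q p₀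
  -- The best alignment is at least as close as rotation by `R₀`, which preserves the distance from
  -- `q` to `p`.
  have hd : ‖rotate R q - p₀‖ ≤ min ε 1 := by
    refine (hbest R₀ hO).trans ?_
    rw [hp₀def, rotate_sub, norm_rotate hO]
    simpa [dist_eq_norm] using hq
  set d := rotate R q - p₀ with hdd
  have hq' : p₀ + d = rotate R q := by rw [hdd, add_sub_cancel]
  have h1 := hlow d (hd.trans (min_le_left _ _)) (asymmetry_eq_zero_iff.mpr hsym)
  have h2 := hexp₂ d (hd.trans (min_le_right _ _))
  rw [hq', gradPhi_rotate hR, norm_rotate hR] at h1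
  rw [hq', Phi_rotate hR, hg₀, inner_zero_left, sub_zero, hp₀def, Phi_rotate hO] at h2
  have h3 := (abs_le.mp h2).2
  have h4 := pow_le_pow_left₀ (by positivity) h1 2
  have h5 : c ^ 2 / (C₂ + 1) * (Phi D lam q - Phi D lam p) ≤
      c ^ 2 / (C₂ + 1) * ((C₂ + 1) * ‖d‖ ^ 2) :=
    mul_le_mul_of_nonneg_left (by nlinarith [sq_nonneg ‖d‖]) (by positivity)
  have h6 : c ^ 2 / (C₂ + 1) * ((C₂ + 1) * ‖d‖ ^ 2) = (c * ‖d‖) ^ 2 := by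
    field_simp
  linarith

theorem hasKLHalf_Phi (hlam : 0 < lam) (hrm : r < m)
    (hS : IsSpectralDecomp (Dᵀ * D) Q fun j => σ j ^ 2) (hσ : ∀ i, 0 ≤ σ i)
    (hne : ∀ i < r, σ i ≠ lam) {l : Fin r} (hl : ∀ b, b ≤ l) (hgap : σ r < σ l)
    {p : FactorSpace n m r} (hp : p ∈ globalMinimizers (Phi D lam)) : HasKLHalf (Phi D lam) p :=
  let ⟨_, hη, h⟩ := exists_gradient_domination hlam hrm hS hσ hne hl hgap hp
  hasKLHalf_of_gradient_domination (hasGradientAt_Phi D lam) (continuous_gradPhi D lam) hη h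

theorem exists_gradient_domination_closedBall (hlam : 0 < lam) (hrm : r < m)
    (hS : IsSpectralDecomp (Dᵀ * D) Q fun j => σ j ^ 2) (hσ : ∀ i, 0 ≤ σ i)
    (hne : ∀ i < r, σ i ≠ lam) {l : Fin r} (hl : ∀ b, b ≤ l) (hgap : σ r < σ l)
    {p : FactorSpace n m r} (hp : p ∈ globalMinimizers (Phi D lam))
    {δ : ℝ} (hδ : 0 ≤ δ) (hδ₁ : ∀ i < r, lam < σ i → δ < √(σ i - lam))
    (hδ₂ : lam < σ l → √(max (σ r - lam) 0) + δ < √(σ l - lam)) :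
    ∃ η > 0, ∀ q ∈ Metric.closedBall p δ,
      η * (Phi D lam q - Phi D lam p) ≤ ‖gradPhi D lam q‖ ^ 2 := by
  refine exists_domination_of_isCompact (isCompact_closedBall p δ)
    (f := fun q => Phi D lam q - Phi D lam p) (fun q => sub_nonneg.mpr (hp q)) fun q hq => ?_
  have hcont : Continuous (Phi (r := r) D lam) := continuous_iff_continuousAt.mpr fun x =>
    (hasGradientAt_Phi D lam x).continuousAt
  -- A critical point of the ball is a global minimizer, where local domination applies; elsewhere a
  -- small constant gives a strict inequality at `q`, which persists nearby.
  rcases eq_or_ne (gradPhi D lam q) 0 with h0 | h0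
  · have hU : frobSq (facU q - facU p) ≤ δ ^ 2 := by
      have h1 : ‖q - p‖ ≤ δ := by simpa [dist_eq_norm] using hq
      have h2 := pow_le_pow_left₀ (norm_nonneg _) h1 2
      rw [factorSpace_norm_sq] at h2
      have h3 := frobSq_nonneg (facV (q - p))
      rw [facU_sub] at h2
      linarith
    have heq : Phi D lam q = Phi D lam p :=
      (isCriticalPair_of_gradPhi_eq_zero h0).factorObj_eq_of_close
        (isCriticalPair_of_gradPhi_eq_zero (gradPhi_eq_zero_of_mem hp)) hlam hrm hS hσ hne hl hgap
        (factorObj_le_of_mem hp) hδ hU hδ₁ hδ₂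
    have hq' : q ∈ globalMinimizers (Phi (r := r) D lam) := fun x => heq ▸ hp x
    obtain ⟨η, hη, h⟩ := exists_gradient_domination hlam hrm hS hσ hne hl hgap hq'
    exact ⟨η, hη, by rwa [heq] at h⟩
  · have hpos : 0 < ‖gradPhi D lam q‖ ^ 2 := by positivity
    have hf : 0 ≤ Phi D lam q - Phi D lam p := sub_nonneg.mpr (hp q)
    refine ⟨‖gradPhi D lam q‖ ^ 2 / (Phi D lam q - Phi D lam p + 1), by positivity, ?_⟩
    refine Eventually.mono (Filter.Tendsto.eventually_lt
      (f := fun y => ‖gradPhi D lam q‖ ^ 2 / (Phi D lam q - Phi D lam p + 1) *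
        (Phi D lam y - Phi D lam p)) (g := fun y => ‖gradPhi D lam y‖ ^ 2)
      (Continuous.tendsto (by fun_prop) q)
      (((continuous_gradPhi D lam).norm.pow 2).tendsto q) ?_) fun y hy => hy.le
    rw [div_mul_eq_mul_div, div_lt_iff₀ (by positivity)]
    change _ < ‖gradPhi D lam q‖ ^ 2 * _
    nlinarith

end

/-- For `y > 0`, `√x - √y = (x - y) / (√x + √y)` is at least `(x - y) / (2 √t)`, twice the bound on
`δ`. -/
theorem sqrt_add_lt_sqrt {x y t δ : ℝ} (hx : 0 < x) (hyx : y < x) (hxt : x ≤ t)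
    (hδ : 0 ≤ δ) (hδ₁ : δ < √x) (hδ₂ : δ ≤ (x - y) / (4 * √t)) : √(max y 0) + δ < √x := by
  rcases le_or_gt y 0 with hy | hy
  · rw [max_eq_right hy, Real.sqrt_zero, zero_add]
    exact hδ₁
  · rw [max_eq_left hy.le]
    have hxs := Real.sqrt_pos.mpr hx
    have hys := Real.sqrt_pos.mpr hy
    have h1 : √x ≤ √t := Real.sqrt_le_sqrt hxt
    have h2 : √y < √x := Real.sqrt_lt_sqrt hy.le hyx
    rw [le_div_iff₀ (by linarith)] at hδ₂
    have e : x - y = (√x - √y) * (√x + √y) := by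
      rw [mul_comm, ← sq_sub_sq, Real.sq_sqrt hx.le, Real.sq_sqrt hy.le]
    nlinarith

end

/-! ### The main theorem. -/

theorem mainTheorem4
    (n m r : ℕ) (hr : 1 ≤ r) (hrn : r < n) (hnm : n ≤ m)
    (M : Matrix (Fin n) (Fin m) ℝ)
    (hgap : singVal M (r + 1) < singVal M r)
    -- `τ 1 > ⋯ > τ s` are the distinct values among `σ_1(M), …, σ_r(M)`; `τ (s + 1) = 0`;
    -- `τ 0 = +∞` is expressed by dropping the conditions in which `τ k` occurs when `k = 0`
    (s : ℕ) (τ : ℕ → ℝ) (hτanti : StrictAntiOn τ (Set.Icc 1 s))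
    (hτ : τ '' Set.Icc 1 s = singVal M '' Set.Icc 1 r) (hτlast : τ (s + 1) = 0) :
    (∀ k ≤ s, ∀ lam : ℝ, τ (k + 1) < lam → (1 ≤ k → lam < τ k) →
      (∀ pbar ∈ globalMinimizers (Phi (r := r) (sigmaMat M) lam),
        (∃ η : ℝ, 0 < η ∧ ∀ δ : ℝ,
          (1 ≤ k → δ ≤ √(τ k - lam) / 2) →
          δ ≤ (lam - τ (k + 1)) / (2 * √(τ 1)) →
          δ ≤ (τ s - singVal M (r + 1)) / (4 * √(τ 1)) →
          ∀ p ∈ Metric.closedBall pbar δ,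
            η * (Phi (sigmaMat M) lam p - Phi (sigmaMat M) lam pbar)
              ≤ ‖gradient (Phi (r := r) (sigmaMat M) lam) p‖ ^ 2) ∧
        HasKLHalf (Phi (r := r) (sigmaMat M) lam) pbar) ∧
      (∀ qbar ∈ globalMinimizers (Phi (r := r) M lam), HasKLHalf (Phi (r := r) M lam) qbar)) ∧
    (∀ᵐ lam : ℝ ∂(MeasureTheory.volume.restrict (Set.Ioi (0 : ℝ))),
      (∀ pbar ∈ globalMinimizers (Phi (r := r) (sigmaMat M) lam),
        HasKLHalf (Phi (r := r) (sigmaMat M) lam) pbar) ∧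
      (∀ qbar ∈ globalMinimizers (Phi (r := r) M lam), HasKLHalf (Phi (r := r) M lam) qbar)) := by
  -- Counting from zero, `σ r` is the singular value just after the gap and `σ l` the one just
  -- before it.
  let σ : ℕ → ℝ := fun i => singVal M (i + 1)
  have hrm : r < m := hrn.trans_le hnm
  have hσ : ∀ i, 0 ≤ σ i := fun i => singVal_nonneg M _
  obtain ⟨Q, hS⟩ := isSpectralDecomp_gram M
  have hS' := isSpectralDecomp_gram_sigmaMat M
  let l : Fin r := ⟨r - 1, by omega⟩
  have hl : ∀ b, b ≤ l := fun b => Fin.le_def.mpr (Nat.le_sub_one_of_lt b.2)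
  have hσl : σ l = singVal M r := by simp only [σ, l, Nat.sub_add_cancel hr]
  have hgap' : σ r < σ l := by rw [hσl]; exact hgap
  have hval : ∀ i < r, ∃ j, 1 ≤ j ∧ j ≤ s ∧ τ j = σ i := fun i hi => by
    have : singVal M (i + 1) ∈ τ '' Set.Icc 1 s := by
      rw [hτ]
      exact ⟨i + 1, ⟨by omega, by omega⟩, rfl⟩
    obtain ⟨j, ⟨h1, h2⟩, h3⟩ := this
    exact ⟨j, h1, h2, h3⟩
  have hKL : ∀ lam : ℝ, 0 < lam → (∀ i < r, σ i ≠ lam) →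
      (∀ pbar ∈ globalMinimizers (Phi (r := r) (sigmaMat M) lam),
        HasKLHalf (Phi (r := r) (sigmaMat M) lam) pbar) ∧
      (∀ qbar ∈ globalMinimizers (Phi (r := r) M lam), HasKLHalf (Phi (r := r) M lam) qbar) :=
    fun lam hlam hne =>
      ⟨fun _ hp => hasKLHalf_Phi hlam hrm hS' hσ hne hl hgap' hp,
        fun _ hp => hasKLHalf_Phi hlam hrm hS hσ hne hl hgap' hp⟩
  refine ⟨fun k hk lam hlo hhi => ?_, ?_⟩
  · have hlam : 0 < lam := by
      refine lt_of_le_of_lt ?_ hlo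
      rcases hk.eq_or_lt with rfl | hks
      · exact hτlast.ge
      · have : τ (k + 1) ∈ singVal M '' Set.Icc 1 r := by
          rw [← hτ]
          exact ⟨k + 1, ⟨by omega, by omega⟩, rfl⟩
        obtain ⟨i, -, hi⟩ := this
        rw [← hi]
        exact singVal_nonneg M i
    -- None of the first `r` singular values lies strictly between two consecutive `τ`, so `lam`
    -- separates them.
    have hcase : ∀ i < r, (1 ≤ k ∧ τ k ≤ σ i) ∨ σ i < lam := fun i hi => by
      obtain ⟨j, h1, h2, h3⟩ := hval i hi
      rw [← h3]
      rcases le_or_gt j k with hjk | hjk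
      · exact Or.inl ⟨h1.trans hjk, hτanti.antitoneOn ⟨h1, h2⟩ ⟨h1.trans hjk, hk⟩ hjk⟩
      · exact Or.inr ((hτanti.antitoneOn ⟨by omega, by omega⟩ ⟨h1, h2⟩ hjk).trans_lt hlo)
    have hne : ∀ i < r, σ i ≠ lam := fun i hi => by
      rcases hcase i hi with ⟨h1, h2⟩ | h
      · exact ((hhi h1).trans_le h2).ne'
      · exact h.ne
    refine ⟨fun pbar hp => ⟨?_, (hKL lam hlam hne).1 pbar hp⟩, (hKL lam hlam hne).2⟩
    simp only [gradient_Phi]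
    obtain ⟨j₀, hj₀, hj₀s, hj₀l⟩ := hval l l.2
    have hs1 : 1 ≤ s := hj₀.trans hj₀s
    have hτs : τ s ≤ σ l := hj₀l ▸ hτanti.antitoneOn ⟨hj₀, hj₀s⟩ ⟨hs1, le_rfl⟩ hj₀s
    have hτ1 : σ l ≤ τ 1 := hj₀l ▸ hτanti.antitoneOn ⟨le_rfl, hs1⟩ ⟨hj₀, hj₀s⟩ hj₀
    have hτ1' : 0 < τ 1 := (hσ r).trans_lt (hgap'.trans_le hτ1)
    -- One radius dominating every admissible `δ`, so that `η` does not depend on `δ`. For `k = 0`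
    -- the infinite term is replaced by a repetition of the other one.
    let δ₀ : ℝ := min (if 1 ≤ k then √(τ k - lam) / 2 else (τ s - σ r) / (4 * √(τ 1)))
      ((τ s - σ r) / (4 * √(τ 1)))
    have hle : ∀ δ : ℝ, (1 ≤ k → δ ≤ √(τ k - lam) / 2) →
        δ ≤ (τ s - singVal M (r + 1)) / (4 * √(τ 1)) → δ ≤ δ₀ := fun δ h1 h3 => by
      refine le_min ?_ h3
      split_ifs with h
      · exact h1 h
      · exact h3
    -- A negative radius makes every admissible ball empty.
    rcases lt_or_ge δ₀ 0 with hneg | hδ₀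
    · refine ⟨1, one_pos, fun δ h1 _ h3 p hp' => ?_⟩
      exact absurd ((dist_nonneg.trans hp').trans (hle δ h1 h3)) (not_le.mpr hneg)
    have hδ₁ : ∀ i < r, lam < σ i → δ₀ < √(σ i - lam) := fun i hi hlt => by
      rcases hcase i hi with ⟨h1, h2⟩ | h
      · have h3 : δ₀ ≤ √(τ k - lam) / 2 := (min_le_left _ _).trans_eq (if_pos h1)
        have h4 := Real.sqrt_pos.mpr (sub_pos.mpr (hhi h1))
        have h5 : √(τ k - lam) ≤ √(σ i - lam) := Real.sqrt_le_sqrt (by linarith)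
        linarith
      · exact absurd h hlt.asymm
    have hδ₂ : lam < σ l → √(max (σ r - lam) 0) + δ₀ < √(σ l - lam) := fun hlt => by
      refine sqrt_add_lt_sqrt (t := τ 1) (by linarith) (by linarith) (by linarith) hδ₀
        (hδ₁ l l.2 hlt) ((min_le_right _ _).trans ?_)
      exact div_le_div_of_nonneg_right (by linarith) (by positivity)
    obtain ⟨η, hη, h⟩ := exists_gradient_domination_closedBall hlam hrm hS' hσ hne hl hgap' hp
      hδ₀ hδ₁ hδ₂
    exact ⟨η, hη, fun δ h1 _ h3 p hp' => h p (Metric.closedBall_subset_closedBall (hle δ h1 h3) hp')⟩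
  · rw [ae_restrict_iff' measurableSet_Ioi]
    -- The only excluded parameters are the first `r` singular values themselves.
    have hnull : ∀ᵐ lam : ℝ, lam ∉ σ '' Set.Iio r :=
      (((Set.finite_Iio r).image σ).countable).ae_notMem volume
    filter_upwards [hnull] with lam hnl hlam
    exact hKL lam hlam fun i hi h => hnl ⟨i, hi, h⟩
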